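/- Let $d\ge 1$. The $d$-crosspolytope is $\operatorname{conv}\{\pm e_1,\dots,\pm e_d\}\subset\mathbb R^d$; its vertices come in $d$ pairs $\{e_i,-e_i\}$. An orientation of its graph is an LP-orientation if there are a realization $Q\subset\mathbb R^d$ (a polytope with the same face lattice) and a linear functional $f$ such that every edge is oriented towards its endpoint with the larger value of $f$ on $Q$. A labeling of an orientation $O$ is a bijection from the vertices to $\{1,\dots,2d\}$ such that all edges are oriented towards the larger label; the pair sequence of an acyclic $O$ is the partition of $\{1,\dots,2d\}$ into the $d$ pairs of labels given to the pairs of vertices by a labeling of $O$. A pair sequence, its pairs listed in ascending order of smaller element, is good if for no $0<k<d$ the first $k$ pairs comprise exactly $\{1,\dots,2k\}$. Let $a_d$ be the number of good pair sequences of length $d$ (partitions of $\{1,\dots,2d\}$ into pairs). For a pair sequence $\pi$ let $s(\pi)$ be the number of its pairs of the form $\{i,i+1\}$, and put $m(\pi)=2^{d-s(\pi)}\,d!$ if $d\ge2$ and $m(\pi)=2$ if $d=1$. Then: 1. Every acyclic orientation of the $d$-crosspolytope has exactly one pair sequence. For every pair sequence $\pi$ of length $d$ there are exactly $2^d\,d!$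 labeled acyclic orientations (acyclic orientations together with a labeling) with pair sequence $\pi$, and exactly $m(\pi)$ acyclic orientations with pair sequence $\pi$. 2. An acyclic orientation is an LP-orientation if and only if its pair sequence is good. Hence there are exactly $2^d\,d!\,a_d$ labeled LP-orientations, and exactly $\sum_{\pi\text{ good}} m(\pi)$ LP-orientations, of the $d$-crosspolytope. 3. $a_d=(2d-1)!!-\sum_{k=1}^{d-1}(2k-1)!!\,a_{d-k}$, where $(2k-1)!!=1\cdot3\cdots(2k-1)$. 4. The pair sequence $(13)(24)(57)(68)$ is the pair sequence of an acyclic orientation of the $4$-crosspolytope, and every acyclic orientation with this pair sequence is Holt-Klee but not an LP-orientation. Here an orientation of a polytope is Holt-Klee if it is acyclic, it has a unique source and a unique sink on every nonempty face (including the polytope itself), and every $k$-face contains at least $k$ distinct directed paths from its source to its sink that are pairwise disjoint except at the endpoints. -/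

import Mathlib

open scoped Nat

/-! ### Polytopes with labelled vertices: faces, graph, realizations

A polytope in `ℝ^d` is given by a labelling `p : V → (Fin d → ℝ)` of its vertices; the polytope is
the convex hull of the range of `p`. -/

/-- The vertex sets of the faces of the polytope `conv (p V)`, including the empty face and the
polytope itself. -/
def polyFaces {V : Type} {d : ℕ} (p : V → Fin d → ℝ) : Set (Set V) :=
  {S | ∃ F : Set (Fin d → ℝ), IsExposed ℝ (convexHull ℝ (Set.range p)) F ∧ S = p ⁻¹' F}

/-- The dimension of the face with vertex set `S`. -/
noncomputable def faceDim {V : Type} {d : ℕ} (p : V → Fin d → ℝ) (S : Set V) : ℕ :=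
  Module.finrank ℝ (vectorSpan ℝ (p '' S))

/-- The graph of a polytope: two distinct vertices are adjacent when they are the vertices of a
face (an edge). -/
def polyGraph {V : Type} {d : ℕ} (p : V → Fin d → ℝ) : SimpleGraph V where
  Adj v w := v ≠ w ∧ ({v, w} : Set V) ∈ polyFaces p
  symm := ⟨fun v w h => ⟨h.1.symm, by rw [Set.pair_comm]; exact h.2⟩⟩
  loopless := ⟨fun _ h => h.1 rfl⟩

/-- `q` is a realization of (the combinatorial type of) the polytope with vertices `p`: the points
`q v` are the pairwise distinct vertices of their convex hull, and the two polytopes have the same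
face lattice, the vertex `q v` corresponding to the vertex `p v`. -/
structure IsRealization {V : Type} {d : ℕ} (p q : V → Fin d → ℝ) : Prop where
  injective : Function.Injective q
  vertex : ∀ v, q v ∈ (convexHull ℝ (Set.range q)).extremePoints ℝ
  faces_eq : polyFaces q = polyFaces p

/-! ### Orientations -/

/-- An orientation of a graph: every edge receives exactly one of its two directions. -/
@[ext]
structure GraphOrientation {V : Type} (G : SimpleGraph V) where
  /-- `arc v w`: there is an edge between `v` and `w`, oriented from `v` to `w`. -/
  arc : V → V → Prop
  arc_or_arc_iff : ∀ v w, (arc v w ∨ arc w v) ↔ G.Adj v w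
  asymm : ∀ v w, arc v w → ¬ arc w v

namespace GraphOrientation

variable {V : Type} {G : SimpleGraph V}

/-- There is no directed cycle. -/
def IsAcyclic (O : GraphOrientation G) : Prop :=
  ∀ v, ¬ Relation.TransGen O.arc v v

/-- `v` is a source of the orientation induced on the vertex set `S`. -/
def IsSourceOn (O : GraphOrientation G) (S : Set V) (v : V) : Prop :=
  v ∈ S ∧ ∀ w ∈ S, ¬ O.arc w v

/-- `v` is a sink of the orientation induced on the vertex set `S`. -/
def IsSinkOn (O : GraphOrientation G) (S : Set V) (v : V) : Prop :=
  v ∈ S ∧ ∀ w ∈ S, ¬ O.arc v w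

/-- `l` lists the vertices of a directed path from `s` to `t` inside `S`. -/
structure IsPathOn (O : GraphOrientation G) (S : Set V) (s t : V) (l : List V) : Prop where
  head : l.head? = some s
  last : l.getLast? = some t
  chain : l.IsChain O.arc
  nodup : l.Nodup
  subset : ∀ v ∈ l, v ∈ S

/-- There are `k` distinct directed paths from `s` to `t` inside `S`, pairwise disjoint except at
their endpoints. -/
def HasDisjointPathsOn (O : GraphOrientation G) (S : Set V) (s t : V) (k : ℕ) : Prop :=
  ∃ P : Fin k → List V, Function.Injective P ∧ (∀ i, O.IsPathOn S s t (P i)) ∧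
    ∀ i j, i ≠ j → ∀ v, v ∈ P i → v ∈ P j → v = s ∨ v = t

end GraphOrientation

/-- The Holt-Klee conditions for an orientation of the polytope with vertices `p`: it is acyclic,
it has a unique source and a unique sink on every nonempty face (the polytope included), and every
`k`-face has `k` directed paths from its source to its sink, pairwise disjoint except at their
endpoints. -/
structure IsHoltKlee {V : Type} {d : ℕ} (p : V → Fin d → ℝ)
    (O : GraphOrientation (polyGraph p)) : Prop where
  acyclic : O.IsAcyclic
  source : ∀ S ∈ polyFaces p, S.Nonempty → ∃! v, O.IsSourceOn S v
  sink : ∀ S ∈ polyFaces p, S.Nonempty → ∃! v, O.IsSinkOn S v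
  paths : ∀ S ∈ polyFaces p, ∀ s t, O.IsSourceOn S s → O.IsSinkOn S t →
    O.HasDisjointPathsOn S s t (faceDim p S)

/-- `O` is an LP-orientation of the polytope with vertices `p`: for some realization `q` and some
linear functional `f`, each edge is oriented towards its vertex with the larger value of `f`. -/
def IsLPOrientation {V : Type} {d : ℕ} (p : V → Fin d → ℝ)
    (O : GraphOrientation (polyGraph p)) : Prop :=
  ∃ q : V → Fin d → ℝ, IsRealization p q ∧ ∃ f : (Fin d → ℝ) →ₗ[ℝ] ℝ,
    ∀ v w, (polyGraph p).Adj v w → (O.arc v w ↔ f (q v) < f (q w))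

/-! ### The crosspolytope -/

/-- The vertices of the `d`-crosspolytope: the `i`-th pair consists of `(i, true)` and
`(i, false)`. -/
abbrev CrossVertex (d : ℕ) : Type := Fin d × Bool

/-- The `d`-crosspolytope is the convex hull of the points `e_i` and `-e_i`. -/
def crosspolytope (d : ℕ) (v : CrossVertex d) : Fin d → ℝ :=
  Pi.single v.1 (if v.2 then 1 else -1)

/-- Orientations of (the graph of) the `d`-crosspolytope. -/
abbrev CrossOrientation (d : ℕ) : Type := GraphOrientation (polyGraph (crosspolytope d))

/-- Labelings of the vertices of the `d`-crosspolytope by `1, …, 2d`. -/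
abbrev CrossLabeling (d : ℕ) : Type := CrossVertex d ≃ Finset.Icc 1 (2 * d)

/-- All edges are oriented towards the vertex with the larger label. -/
def CrossOrientation.IsLabeledBy {d : ℕ} (O : CrossOrientation d) (lab : CrossLabeling d) : Prop :=
  ∀ v w, O.arc v w → (lab v : ℕ) < (lab w : ℕ)

/-! ### Pair sequences -/

/-- The pair sequences of length `d`: the partitions of `{1, …, 2d}` into pairs. -/
def pairSequences (d : ℕ) : Finset (Finset (Finset ℕ)) :=
  {π ∈ (Finset.powersetCard 2 (Finset.Icc 1 (2 * d))).powerset |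
    (∀ p ∈ π, ∀ q ∈ π, p ≠ q → Disjoint p q) ∧ π.biUnion id = Finset.Icc 1 (2 * d)}

/-- The pairs of labels given to the pairs of vertices. -/
def CrossLabeling.pairs {d : ℕ} (lab : CrossLabeling d) : Finset (Finset ℕ) :=
  Finset.univ.image fun i : Fin d => {(lab (i, true) : ℕ), (lab (i, false) : ℕ)}

/-- `π` is the pair sequence of `O`: it arises from a labeling corresponding to `O`. -/
def CrossOrientation.HasPairSequence {d : ℕ} (O : CrossOrientation d)
    (π : Finset (Finset ℕ)) : Prop :=
  ∃ lab : CrossLabeling d, O.IsLabeledBy lab ∧ lab.pairs = π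

/-- The first `k` pairs of `π`, the pairs being listed in ascending order of smaller element. -/
def firstPairs (π : Finset (Finset ℕ)) (k : ℕ) : Finset (Finset ℕ) :=
  {p ∈ π | (π.filter fun q => q.min < p.min).card < k}

/-- A pair sequence of length `d` is good if for no `0 < k < d` its first `k` pairs comprise
exactly the elements `1, …, 2k`. -/
def IsGoodPairSequence (d : ℕ) (π : Finset (Finset ℕ)) : Prop :=
  ∀ k < d, 0 < k → (firstPairs π k).biUnion id ≠ Finset.Icc 1 (2 * k)

instance (d : ℕ) : DecidablePred (IsGoodPairSequence d) := fun π => by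
  unfold IsGoodPairSequence; infer_instance

/-- The good pair sequences of length `d`. -/
def goodPairSequences (d : ℕ) : Finset (Finset (Finset ℕ)) :=
  {π ∈ pairSequences d | IsGoodPairSequence d π}

/-- The number `a_d` of good pair sequences of length `d`. -/
def numGood (d : ℕ) : ℕ := (goodPairSequences d).card

/-- The number of pairs of the form `{i, i + 1}` in a pair sequence. -/
def numConsecutive (π : Finset (Finset ℕ)) : ℕ :=
  (π.filter fun p => ∃ i ∈ p, i + 1 ∈ p).card

/-- The number `2^(d-s) d!`, where `s` is the number of consecutive pairs in `π`; for `d = 1` it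
is `2` instead (switching the two vertices of a pair with consecutive labels does not change the
orientation, except for `d = 1`, where these two vertices are joined by an edge). -/
def orientationMultiplicity (d : ℕ) (π : Finset (Finset ℕ)) : ℕ :=
  if d = 1 then 2 else 2 ^ (d - numConsecutive π) * d !

/-! The faces of a polytope are the zero sets of its nonnegative affine functions, so face lattices
can be handled through `affineFunctions` alone. For the crosspolytope the proper faces are exactly
the vertex sets without antipodal pairs; hence for `d ≥ 2` two vertices are adjacent exactly when
they are not antipodal.

Counting: a labeling determines its orientation, and the signed permutations act simply transitively
on the labelings with a given pair sequence. Conversely, for `d ≥ 2` the label of a vertex is one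
plus its in-degree, plus one more if its antipode comes earlier (`label_eq`). So an orientation
determines its labeling up to switching antipodal vertices with consecutive labels, and choosing one
labeling from each such class counts the orientations.

Bad implies not LP (`not_separated`): if the first `k` pairs carry the labels `1, …, 2k`, a level
set of the functional separates these pairs from the others. Rotating this hyperplane about larger
and larger faces yields a supporting hyperplane of a proper face containing an antipodal pair, which
is impossible.

Good implies LP (`exists_isCrossLike`): add the pairs in order of smaller label, each in a new
coordinate direction, so that the segment of the new pair crosses the hull of the earlier vertices
at a relatively interior point. Goodness says that some earlier vertex has a label above the smaller
label of the new pair, which is what is needed to give the crossing point the required value of the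
functional.

The recursion cuts a pair sequence at its last split: an arbitrary sequence followed by a good one.
In the example, `(13)(24)` is split off, so the orientations are not LP. The Holt-Klee conditions
hold automatically on simplices, and on the whole polytope four paths of length two suffice. -/

/-! ### Faces as zero sets of nonnegative affine functions. -/

/-- The functions on the vertices which are restrictions of affine functions on `ℝ^d`. -/
def affineFunctions {V : Type} {d : ℕ} (q : V → Fin d → ℝ) : Submodule ℝ (V → ℝ) where
  carrier := {h | ∃ l : (Fin d → ℝ) →ₗ[ℝ] ℝ, ∃ c : ℝ, ∀ v, h v = l (q v) + c}
  add_mem' := by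
    rintro h₁ h₂ ⟨l₁, c₁, e₁⟩ ⟨l₂, c₂, e₂⟩
    exact ⟨l₁ + l₂, c₁ + c₂, fun v => by simp [e₁, e₂]; ring⟩
  zero_mem' := ⟨0, 0, fun v => by simp⟩
  smul_mem' := by
    rintro t h ⟨l, c, e⟩
    exact ⟨t • l, t * c, fun v => by simp [e]; ring⟩

theorem mem_polyFaces_iff {V : Type} {d : ℕ} (q : V → Fin d → ℝ) (S : Set V) :
    S ∈ polyFaces q ↔ ∃ h ∈ affineFunctions q, (∀ v, 0 ≤ h v) ∧ S = {v | h v = 0} := by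
  constructor
  · rintro ⟨F, hF, rfl⟩
    rcases (q ⁻¹' F).eq_empty_or_nonempty with he | ⟨v₀, hv₀⟩
    -- The constant function 1 cuts out the empty face.
    · exact ⟨fun _ => 1, ⟨0, 1, by simp⟩, by simp, by simp [he]⟩
    · obtain ⟨l, hl⟩ := hF ⟨_, hv₀⟩
      have hv₀' := hv₀
      rw [Set.mem_preimage, hl] at hv₀'
      have hmem : ∀ v, q v ∈ convexHull ℝ (Set.range q) := fun v =>
        subset_convexHull ℝ _ ⟨v, rfl⟩
      refine ⟨fun v => l (q v₀) - l (q v), ⟨-l.toLinearMap, l (q v₀), fun v => by simp; ring⟩,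
        fun v => sub_nonneg.2 (hv₀'.2 _ (hmem v)), ?_⟩
      ext v
      rw [Set.mem_preimage, hl]
      simp only [Set.mem_ofPred_eq, sub_eq_zero]
      exact ⟨fun h => le_antisymm (h.2 _ (hmem v₀)) (hv₀'.2 _ (hmem v)),
        fun h => ⟨hmem v, fun y hy => h ▸ hv₀'.2 y hy⟩⟩
  · rintro ⟨h, ⟨l, c, hl⟩, hnn, rfl⟩
    rcases ({v | h v = 0} : Set V).eq_empty_or_nonempty with he | ⟨v₀, hv₀⟩
    · exact ⟨∅, fun hne => absurd hne (by simp), by simp [he]⟩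
    · have hconv : ∀ y ∈ convexHull ℝ (Set.range q), 0 ≤ l y + c := by
        intro y hy
        have hsub : convexHull ℝ (Set.range q) ⊆ {y | -c ≤ l y} := by
          refine convexHull_min ?_ (convex_halfSpace_ge l.isLinear _)
          rintro _ ⟨v, rfl⟩
          have := hnn v
          rw [hl] at this
          simp only [Set.mem_ofPred_eq]
          linarith
        have := hsub hy
        simp only [Set.mem_ofPred_eq] at this
        linarith
      have hv₀' : l (q v₀) + c = 0 := by rw [← hl]; exact hv₀
      refine ⟨{x ∈ convexHull ℝ (Set.range q) | ∀ y ∈ convexHull ℝ (Set.range q),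
        (-l).toContinuousLinearMap y ≤ (-l).toContinuousLinearMap x}, fun _ => ⟨_, rfl⟩, ?_⟩
      ext v
      simp only [Set.mem_ofPred_eq, Set.mem_preimage, LinearMap.coe_toContinuousLinearMap',
        LinearMap.neg_apply, neg_le_neg_iff, hl]
      refine ⟨fun e => ⟨subset_convexHull ℝ _ ⟨v, rfl⟩, fun y hy => ?_⟩, fun e => ?_⟩
      · linarith [hconv y hy]
      · have h1 := e.2 (q v₀) (subset_convexHull ℝ _ ⟨v₀, rfl⟩)
        have h2 := hconv _ e.1
        linarith

/-! ### Face lattice and graph of the crosspolytope. -/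

/-- `S` contains no pair of opposite vertices. -/
def IsAntipodeFree {d : ℕ} (S : Set (CrossVertex d)) : Prop :=
  ∀ i b, (i, b) ∈ S → (i, !b) ∉ S

/-- A facial criterion for being a realization of the crosspolytope: every transversal of the
antipodal pairs is a facet, and no proper face contains an antipodal pair. -/
structure IsCrossLike {d : ℕ} (q : CrossVertex d → Fin d → ℝ) : Prop where
  facet : ∀ ε : Fin d → Bool, ∃ h ∈ affineFunctions q, ∀ i, h (i, ε i) = 0 ∧ 0 < h (i, !ε i)
  eq_zero : ∀ h ∈ affineFunctions q, (∀ v, 0 ≤ h v) →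
    ∀ i, (∀ b, h (i, b) = 0) → ∀ v, h v = 0

theorem exists_transversal {d : ℕ} {S : Set (CrossVertex d)} (hS : IsAntipodeFree S)
    {v : CrossVertex d} (hv : v ∉ S) :
    ∃ ε : Fin d → Bool, (∀ i b, (i, b) ∈ S → b = ε i) ∧ ε v.1 = !v.2 := by
  classical
  -- The sign is `!v.2` unless `S` forces `v.2`; as `v ∉ S`, the resulting facet contains `S` and
  -- misses `v`.
  refine ⟨fun j => if (j, v.2) ∈ S then v.2 else if (j, !v.2) ∈ S then !v.2 else !v.2, ?_, ?_⟩
  · intro i b hb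
    have h := hS i b hb
    obtain ⟨j, c⟩ := v
    by_cases hbc : b = c
    · subst hbc; simp [hb]
    · have : b = !c := by cases b <;> cases c <;> simp_all
      subst this
      simp only [Bool.not_not] at h
      simp [h]
  · simp [hv]

/-- An antipode-free set is the intersection of the transversal facets containing it, by
`exists_transversal`. The sum of the functions of these facets therefore has exactly this set as its
zero set. -/
theorem IsCrossLike.polyFaces_eq {d : ℕ} {q : CrossVertex d → Fin d → ℝ} (hq : IsCrossLike q) :
    polyFaces q = {S | S = Set.univ ∨ IsAntipodeFree S} := by
  classical
  ext S
  rw [mem_polyFaces_iff]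
  constructor
  · rintro ⟨h, hh, hnn, rfl⟩
    by_cases hS : IsAntipodeFree {v | h v = 0}
    · exact Or.inr hS
    · left
      unfold IsAntipodeFree at hS
      push Not at hS
      obtain ⟨i, b, h1, h2⟩ := hS
      refine Set.eq_univ_of_forall (hq.eq_zero h hh hnn i fun c => ?_)
      by_cases hc : c = b
      · rw [hc]; exact h1
      · have : c = !b := by cases b <;> cases c <;> simp_all
        rw [this]; exact h2
  · rintro (rfl | hS)
    · exact ⟨0, Submodule.zero_mem _, by simp, by simp⟩
    · choose h hmem hh using hq.facet
      have hnn : ∀ ε v, 0 ≤ h ε v := by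
        rintro ε ⟨i, b⟩
        by_cases hb : b = ε i
        · rw [hb, (hh ε i).1]
        · have : b = !ε i := by cases b <;> cases hε : ε i <;> simp_all
          rw [this]; exact (hh ε i).2.le
      set E : Finset (Fin d → Bool) := Finset.univ.filter fun ε => ∀ i b, (i, b) ∈ S → b = ε i
        with hE
      refine ⟨∑ ε ∈ E, h ε, Submodule.sum_mem _ fun ε _ => hmem ε, fun v => ?_, ?_⟩
      · rw [Finset.sum_apply]; exact Finset.sum_nonneg fun ε _ => hnn ε v
      · ext ⟨i, b⟩
        simp only [Set.mem_ofPred_eq, Finset.sum_apply]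
        constructor
        · intro hv
          refine Finset.sum_eq_zero fun ε hε => ?_
          rw [hE, Finset.mem_filter] at hε
          rw [hε.2 i b hv]; exact (hh ε i).1
        · intro h0
          by_contra hv
          obtain ⟨ε, hε, hεv⟩ := exists_transversal hS hv
          have h1 : ε ∈ E := by simpa [hE] using hε
          have h2 := (Finset.sum_eq_zero_iff_of_nonneg fun ε _ => hnn ε (i, b)).1 h0 ε h1
          have h3 := (hh ε i).2
          simp only at hεv
          rw [hεv, Bool.not_not, h2] at h3
          exact lt_irrefl _ h3

theorem crosspolytope_isCrossLike (d : ℕ) : IsCrossLike (crosspolytope d) := by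
  constructor
  · intro ε
    refine ⟨fun v => 1 - (if ε v.1 then 1 else -1) * (if v.2 then 1 else -1), ?_, fun i => ?_⟩
    · refine ⟨-∑ i, (if ε i then (1 : ℝ) else -1) • LinearMap.proj i, 1, fun v => ?_⟩
      simp only [LinearMap.neg_apply, LinearMap.sum_apply, LinearMap.smul_apply,
        LinearMap.proj_apply, crosspolytope, smul_eq_mul]
      rw [Finset.sum_eq_single v.1]
      · simp; ring
      · intro j _ hj; simp [hj]
      · simp
    · cases h : ε i <;> simp [h]
  · rintro h ⟨l, c, hl⟩ hnn i h0 v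
    -- All antipodal pairs have the same midpoint. If `h` vanishes on one pair, it vanishes there,
    -- and nonnegativity forces it to vanish on every other pair.
    have key : ∀ j, h (j, true) + h (j, false) = 2 * c := by
      intro j
      have : crosspolytope d (j, false) = -crosspolytope d (j, true) := by
        simp [crosspolytope, Pi.single_neg]
      rw [hl, hl, this, map_neg]; ring
    have hc := key i
    rw [h0, h0] at hc
    have h1 := key v.1
    have h2 := hnn (v.1, true)
    have h3 := hnn (v.1, false)
    obtain ⟨j, b⟩ := v
    cases b <;> simp only at * <;> linarith

theorem polyFaces_crosspolytope (d : ℕ) :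
    polyFaces (crosspolytope d) = {S | S = Set.univ ∨ IsAntipodeFree S} :=
  (crosspolytope_isCrossLike d).polyFaces_eq

theorem IsCrossLike.isRealization {d : ℕ} {q : CrossVertex d → Fin d → ℝ}
    (hq : IsCrossLike q) : IsRealization (crosspolytope d) q := by
  have hface : ∀ v : CrossVertex d, ({v} : Set (CrossVertex d)) ∈ polyFaces q := by
    rintro ⟨i, b⟩
    rw [hq.polyFaces_eq]
    right
    rintro j c hj hj'
    rw [Set.mem_singleton_iff, Prod.mk.injEq] at hj hj'
    have := hj.2.trans hj'.2.symm
    cases c <;> simp at this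
  refine ⟨fun v w hvw => ?_, fun v => ?_, by rw [hq.polyFaces_eq, polyFaces_crosspolytope]⟩
  · obtain ⟨h, ⟨l, c, hl⟩, -, hS⟩ := (mem_polyFaces_iff q _).1 (hface w)
    have hw : h w = 0 := by
      have : w ∈ ({w} : Set (CrossVertex d)) := rfl
      rwa [hS] at this
    have : v ∈ ({w} : Set (CrossVertex d)) := by
      rw [hS, Set.mem_ofPred_eq, hl, hvw, ← hl, hw]
    exact this
  · obtain ⟨F, hF, hS⟩ := hface v
    have hv : q v ∈ F := by
      have : v ∈ ({v} : Set (CrossVertex d)) := rfl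
      rwa [hS] at this
    -- The exposed face through `q v` is compact, hence has an extreme point. This is some `q w`
    -- with `w` in the face `{v}`, so it is `q v`.
    have hcomp : IsCompact F :=
      IsExposed.isCompact hF ((Set.finite_range q).isCompact_convexHull ℝ)
    obtain ⟨x, hx⟩ := hcomp.extremePoints_nonempty ⟨_, hv⟩
    have hx' := hF.isExtreme.extremePoints_subset_extremePoints hx
    obtain ⟨w, rfl⟩ := extremePoints_convexHull_subset hx'
    have hw : w ∈ q ⁻¹' F := hx.1
    rw [← hS, Set.mem_singleton_iff] at hw
    rwa [← hw]

theorem crosspolytope_adj {d : ℕ} (hd : 2 ≤ d) (v w : CrossVertex d) :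
    (polyGraph (crosspolytope d)).Adj v w ↔ v.1 ≠ w.1 := by
  change v ≠ w ∧ ({v, w} : Set _) ∈ polyFaces (crosspolytope d) ↔ _
  rw [polyFaces_crosspolytope]
  constructor
  · rintro ⟨hne, h | h⟩ heq
    · obtain ⟨j, hj⟩ : ∃ j : Fin d, j ≠ v.1 := by
        have : Nontrivial (Fin d) := Fin.nontrivial_iff_two_le.2 hd
        exact exists_ne _
      have : ((j, true) : CrossVertex d) ∈ ({v, w} : Set _) := h ▸ Set.mem_univ _
      rcases this with h | h
      · exact hj (by rw [← h])
      · rw [Set.mem_singleton_iff] at h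
        exact hj (by rw [heq, ← h])
    · obtain ⟨i, b⟩ := v
      obtain ⟨j, c⟩ := w
      simp only at heq
      subst heq
      have hc : c = !b := by cases b <;> cases c <;> simp_all
      subst hc
      exact h i b (by simp) (by simp)
  · intro hne
    refine ⟨fun h => hne (by rw [h]), Or.inr ?_⟩
    rintro i b (h | h) (h' | h')
    · have := congrArg Prod.snd (h.trans h'.symm); cases b <;> simp at this
    · have h1 : i = v.1 := congrArg Prod.fst h
      have h2 : i = w.1 := congrArg Prod.fst (Set.mem_singleton_iff.1 h')
      exact hne (h1.symm.trans h2)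
    · have h1 : i = w.1 := congrArg Prod.fst (Set.mem_singleton_iff.1 h)
      have h2 : i = v.1 := congrArg Prod.fst h'
      exact hne (h2.symm.trans h1)
    · have := congrArg Prod.snd (h.trans h'.symm); cases b <;> simp at this

/-! ### The obstruction: no hyperplane separates antipodal pairs. -/

/-- Rotation of a hyperplane. The zero set of `g` contains the face `σ`, which lies over `I`; adding
a nonnegative multiple of a supporting function `ℓ` of `σ` keeps `g` zero on `σ` and positive
outside `I`. Rotating until the first vertex of an untouched pair is hit enlarges `σ`. Once all
pairs of `I` are touched, rotating until `g` is nonnegative everywhere adds the antipode of a vertex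
of `σ`. The induction is on the number of untouched pairs. -/
theorem false_of_separated_aux {d : ℕ} {q : CrossVertex d → Fin d → ℝ}
    (hq : polyFaces q = {S | S = Set.univ ∨ IsAntipodeFree S}) {I : Set (Fin d)}
    (hco : ∃ j, j ∉ I) (n : ℕ) :
    ∀ (σ : Set (CrossVertex d)), ∀ g ∈ affineFunctions q, IsAntipodeFree σ →
      (∀ v ∈ σ, v.1 ∈ I ∧ g v = 0) →
      (∀ v : CrossVertex d, v.1 ∈ I → (∀ b, (v.1, b) ∉ σ) → g v ≤ 0) →
      (∀ v : CrossVertex d, v.1 ∉ I → 0 < g v) →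
      (∃ v, v ∉ σ ∧ v.1 ∈ I ∧ g v ≤ 0) →
      {i ∈ I | ∀ b, (i, b) ∉ σ}.ncard ≤ n → False := by
  classical
  induction n with
  | zero =>
    intro σ g hg hσ hσg _ hU ⟨u, huσ, _, hu⟩ hn
    have hmet : ∀ i ∈ I, ∃ b, (i, b) ∈ σ := by
      intro i hi
      rw [Nat.le_zero, Set.ncard_eq_zero (Set.toFinite _)] at hn
      by_contra! hcon
      have : i ∈ {i ∈ I | ∀ b, (i, b) ∉ σ} := ⟨hi, hcon⟩
      rw [hn] at this
      exact this
    obtain ⟨ℓ, hℓ, hℓnn, hℓσ⟩ := (mem_polyFaces_iff q σ).1 (by rw [hq]; exact Or.inr hσ)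
    have hℓ0 : ∀ v ∈ σ, ℓ v = 0 := fun v hv => by rw [hℓσ] at hv; exact hv
    have hℓpos : ∀ v, v ∉ σ → 0 < ℓ v := fun v hv =>
      lt_of_le_of_ne (hℓnn v) fun h => hv (by rw [hℓσ]; exact h.symm)
    -- The maximal ratio is the least multiple of `ℓ` making `g` nonnegative; the vertex `u` ensures
    -- that it is at least 0.
    obtain ⟨w, hwσ, hw⟩ := Set.exists_max_image σᶜ (fun v => -g v / ℓ v) (Set.toFinite _) ⟨u, huσ⟩
    set t := -g w / ℓ w with ht
    have ht0 : 0 ≤ t := le_trans (div_nonneg (by linarith) (hℓnn u)) (hw u huσ)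
    have hge : ∀ v, 0 ≤ (g + t • ℓ) v := by
      intro v
      simp only [Pi.add_apply, Pi.smul_apply, smul_eq_mul]
      by_cases hv : v ∈ σ
      · rw [(hσg v hv).2, hℓ0 v hv]; simp
      · have := (div_le_iff₀ (hℓpos v hv)).1 (hw v hv)
        linarith
    have hzero : ∀ v ∈ σ, (g + t • ℓ) v = 0 := fun v hv => by
      simp [(hσg v hv).2, hℓ0 v hv]
    have hw0 : (g + t • ℓ) w = 0 := by
      have : t * ℓ w = -g w := div_mul_cancel₀ _ (hℓpos w hwσ).ne'
      simp only [Pi.add_apply, Pi.smul_apply, smul_eq_mul, this]; ring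
    have hpos : ∀ v : CrossVertex d, v.1 ∉ I → 0 < (g + t • ℓ) v := fun v hv => by
      have h1 := hU v hv
      have h2 := mul_nonneg ht0 (hℓnn v)
      simp only [Pi.add_apply, Pi.smul_apply, smul_eq_mul]
      linarith
    have hmem : {v | (g + t • ℓ) v = 0} ∈ polyFaces q :=
      (mem_polyFaces_iff q _).2 ⟨_, Submodule.add_mem _ hg (Submodule.smul_mem _ t hℓ), hge, rfl⟩
    rw [hq] at hmem
    rcases hmem with h | h
    · obtain ⟨j, hj⟩ := hco
      have h1 := hpos (j, true) hj
      have h2 : (j, true) ∈ {v | (g + t • ℓ) v = 0} := by rw [h]; trivial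
      rw [Set.mem_ofPred_eq] at h2
      exact h1.ne' h2
    -- The new zero `w` lies over `I`, and its pair already meets `σ`, so `w` is the antipode of a
    -- vertex of `σ`.
    · have hwI : w.1 ∈ I := by
        by_contra hwI
        exact (hpos w hwI).ne' hw0
      obtain ⟨b, hb⟩ := hmet _ hwI
      have hb2 : w = (w.1, !b) := by
        have : w.2 ≠ b := fun hc => hwσ (by rw [← hc] at hb; exact hb)
        ext1
        · rfl
        · revert this; cases w.2 <;> cases b <;> simp
      exact h w.1 b (hzero _ hb) (by rw [← hb2]; exact hw0)
  | succ n ih =>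
    intro σ g hg hσ hσg hL hU hex hn
    by_cases hmet : ∃ i ∈ I, ∀ b, (i, b) ∉ σ
    · obtain ⟨i, hi, hib⟩ := hmet
      obtain ⟨ℓ, hℓ, hℓnn, hℓσ⟩ := (mem_polyFaces_iff q σ).1 (by rw [hq]; exact Or.inr hσ)
      have hℓ0 : ∀ v ∈ σ, ℓ v = 0 := fun v hv => by rw [hℓσ] at hv; exact hv
      have hℓpos : ∀ v, v ∉ σ → 0 < ℓ v := fun v hv =>
        lt_of_le_of_ne (hℓnn v) fun h => hv (by rw [hℓσ]; exact h.symm)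
      -- The minimal ratio stops the rotation at the first vertex reached, so the other untouched
      -- vertices stay on the nonpositive side.
      obtain ⟨w, ⟨hwI, hwσ⟩, hw⟩ := Set.exists_min_image
        {v : CrossVertex d | v.1 ∈ I ∧ ∀ b, (v.1, b) ∉ σ} (fun v => -g v / ℓ v)
        (Set.toFinite _) ⟨(i, true), hi, hib⟩
      set t := -g w / ℓ w with ht
      have ht0 : 0 ≤ t := div_nonneg (by linarith [hL w hwI hwσ]) (hℓnn w)
      have hle : ∀ v : CrossVertex d, v.1 ∈ I → (∀ b, (v.1, b) ∉ σ) → (g + t • ℓ) v ≤ 0 := by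
        intro v hv hvσ
        have := (le_div_iff₀ (hℓpos v (hvσ v.2))).1 (hw v ⟨hv, hvσ⟩)
        simp only [Pi.add_apply, Pi.smul_apply, smul_eq_mul]
        linarith
      have hw0 : (g + t • ℓ) w = 0 := by
        have : t * ℓ w = -g w := div_mul_cancel₀ _ (hℓpos w (hwσ w.2)).ne'
        simp only [Pi.add_apply, Pi.smul_apply, smul_eq_mul, this]; ring
      refine ih (insert w σ) (g + t • ℓ)
        (Submodule.add_mem _ hg (Submodule.smul_mem _ t hℓ)) ?_ ?_ ?_ ?_ ?_ ?_
      · rintro j b (h | h) (h' | h')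
        · have := congrArg Prod.snd (h.trans h'.symm); cases b <;> simp at this
        · rw [← h] at hwσ; exact hwσ _ h'
        · rw [← h'] at hwσ; exact hwσ _ h
        · exact hσ j b h h'
      · rintro v (rfl | hv)
        · exact ⟨hwI, hw0⟩
        · exact ⟨(hσg v hv).1, by simp [(hσg v hv).2, hℓ0 v hv]⟩
      · exact fun v hv hvσ => hle v hv fun b hb => hvσ b (Or.inr hb)
      · intro v hv
        have h1 := hU v hv
        have h2 := mul_nonneg ht0 (hℓnn v)
        simp only [Pi.add_apply, Pi.smul_apply, smul_eq_mul]
        linarith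
      -- The antipode of the vertex just added is still on the nonpositive side and outside the new
      -- face.
      · refine ⟨(w.1, !w.2), ?_, hwI, hle _ hwI hwσ⟩
        rintro (h | h)
        · have := congrArg Prod.snd h
          simp at this
        · exact hwσ _ h
      · have : {i ∈ I | ∀ b, (i, b) ∉ insert w σ} ⊂ {i ∈ I | ∀ b, (i, b) ∉ σ} := by
          refine ⟨fun j hj => ⟨hj.1, fun b hb => hj.2 b (Or.inr hb)⟩, fun hsub => ?_⟩
          exact (hsub (⟨hwI, hwσ⟩ : w.1 ∈ {i ∈ I | ∀ b, (i, b) ∉ σ})).2 w.2 (Or.inl rfl)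
        have := Set.ncard_lt_ncard this (Set.toFinite _)
        omega
    · refine ih σ g hg hσ hσg hL hU hex ?_
      have : {i ∈ I | ∀ b, (i, b) ∉ σ} = ∅ := by
        rw [Set.eq_empty_iff_forall_notMem]
        exact fun j hj => hmet ⟨j, hj⟩
      rw [this]; simp

/-- In a realization of the crosspolytope, no hyperplane separates the vertices of some of the
antipodal pairs from the vertices of the others. -/
theorem not_separated {d : ℕ} {q : CrossVertex d → Fin d → ℝ}
    (hq : polyFaces q = {S | S = Set.univ ∨ IsAntipodeFree S}) {I : Set (Fin d)}
    (hne : I.Nonempty) (hco : ∃ j, j ∉ I) {g : CrossVertex d → ℝ} (hg : g ∈ affineFunctions q)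
    (hL : ∀ v : CrossVertex d, v.1 ∈ I → g v ≤ 0)
    (hU : ∀ v : CrossVertex d, v.1 ∉ I → 0 < g v) : False := by
  obtain ⟨i, hi⟩ := hne
  exact false_of_separated_aux hq hco _ ∅ g hg (fun _ _ h => absurd h (by simp)) (by simp)
    (fun v hv _ => hL v hv) hU ⟨(i, true), by simp, hi, hL _ hi⟩ le_rfl

/-! ### Realizations with prescribed values of a functional. -/

/-- Start with equal weights, raise the weight of `u` or `w` until the weighted deviations from `c`
cancel, and normalize. -/
theorem exists_weights {ι : Type*} (s : Finset ι) (ψ : ι → ℝ) (c : ℝ) {u w : ι} (hu : u ∈ s)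
    (hw : w ∈ s) (huc : ψ u < c) (hcw : c < ψ w) :
    ∃ W : ι → ℝ, (∀ v ∈ s, 0 < W v) ∧ ∑ v ∈ s, W v = 1 ∧ ∑ v ∈ s, W v * ψ v = c := by
  classical
  obtain ⟨W, hpos, hsum⟩ : ∃ W : ι → ℝ, (∀ v ∈ s, 0 < W v) ∧ ∑ v ∈ s, W v * (ψ v - c) = 0 := by
    set K := ∑ v ∈ s, (ψ v - c) with hK
    have key : ∀ x ∈ s, ∀ A : ℝ, ∑ v ∈ s, (1 + if v = x then A else 0) * (ψ v - c) =
        K + A * (ψ x - c) := by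
      intro x hx A
      simp only [add_mul, one_mul, ite_mul, zero_mul, Finset.sum_add_distrib]
      rw [Finset.sum_ite_eq' s x, if_pos hx]
    rcases le_total 0 K with h | h
    · refine ⟨fun v => 1 + if v = u then K / (c - ψ u) else 0, fun v _ => ?_, ?_⟩
      · have : 0 ≤ K / (c - ψ u) := div_nonneg h (by linarith)
        dsimp only
        split_ifs <;> linarith
      · rw [key u hu]
        have : c - ψ u ≠ 0 := by linarith
        field_simp; ring
    · refine ⟨fun v => 1 + if v = w then -K / (ψ w - c) else 0, fun v _ => ?_, ?_⟩
      · have : 0 ≤ -K / (ψ w - c) := div_nonneg (by linarith) (by linarith)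
        dsimp only
        split_ifs <;> linarith
      · rw [key w hw]
        have : ψ w - c ≠ 0 := by linarith
        field_simp; ring
  have hS : 0 < ∑ v ∈ s, W v := Finset.sum_pos hpos ⟨u, hu⟩
  refine ⟨fun v => W v / ∑ v ∈ s, W v, fun v hv => div_pos (hpos v hv) hS, ?_, ?_⟩
  · rw [← Finset.sum_div, div_self hS.ne']
  · simp only [div_mul_eq_mul_div, ← Finset.sum_div]
    rw [div_eq_iff hS.ne']
    simp only [mul_sub, Finset.sum_sub_distrib, ← Finset.sum_mul] at hsum
    linarith

theorem exists_recursive {ι α : Type*} (m : ι → ℕ) (F : (i : ι) → ((j : ι) → m j < m i → α) → α) :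
    ∃ q : ι → α, ∀ i, q i = F i fun j _ => q j :=
  ⟨(measure m).wf.fix F, fun i => (measure m).wf.fix_eq F i⟩

/-- A realization of the crosspolytope with prescribed values of the sum of coordinates: the pairs
are added in ascending order of `m`, the segment spanned by a new pair meeting the convex hull of
the earlier vertices in a relatively interior point. -/
theorem exists_isCrossLike {d : ℕ} (m : Fin d → ℕ) (hm : Function.Injective m)
    (ψ : CrossVertex d → ℝ) (c : Fin d → ℝ) (W : Fin d → CrossVertex d → ℝ)
    (hpos : ∀ i (v : CrossVertex d), m v.1 < m i → 0 < W i v)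
    (hzero : ∀ i (v : CrossVertex d), ¬ m v.1 < m i → W i v = 0)
    (hone : ∀ i, (∃ j, m j < m i) → ∑ v, W i v = 1)
    (hc : ∀ i, ∑ v, W i v * ψ v = c i)
    (hopp : ∀ i b, (ψ (i, b) - c i) * (ψ (i, !b) - c i) < 0) :
    ∃ q : CrossVertex d → Fin d → ℝ, IsCrossLike q ∧ ∀ v, ∑ k, q v k = ψ v := by
  classical
  -- The `i`-th segment runs in direction `e_i` through the weighted mean `x i` of the earlier
  -- vertices. The coordinate sum is `c i` at `x i`, so the offsets `ψ (i, b) - c i` give the values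
  -- `ψ`; their opposite signs put `x i` strictly inside the segment.
  obtain ⟨q', hq'⟩ := exists_recursive (α := Bool → Fin d → ℝ) m fun i rec b =>
    (∑ v : CrossVertex d, if h : m v.1 < m i then W i v • rec v.1 h v.2 else 0) +
      (ψ (i, b) - c i) • Pi.single i (1 : ℝ)
  set q : CrossVertex d → Fin d → ℝ := fun v => q' v.1 v.2 with hqdef
  set x : Fin d → Fin d → ℝ := fun i => ∑ v, W i v • q v with hx
  have hq : ∀ i b, q (i, b) = x i + (ψ (i, b) - c i) • Pi.single i (1 : ℝ) := by
    intro i b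
    simp only [hqdef, hx]
    rw [hq' i]
    refine congrArg₂ _ (Finset.sum_congr rfl fun v _ => ?_) rfl
    split_ifs with h
    · rfl
    · rw [hzero i v h, zero_smul]
  have hqk : ∀ i b k, q (i, b) k = x i k + if k = i then ψ (i, b) - c i else 0 := by
    intro i b k
    rw [hq]
    simp [Pi.single_apply]
  have hxk : ∀ i k, x i k = ∑ v, W i v * q v k := by
    intro i k
    simp [hx, Finset.sum_apply]
  -- The point `x i` involves only the coordinates of earlier pairs. By this triangularity the
  -- coefficients of a facet function can be solved for one at a time.
  have hsupp : ∀ n i, m i = n → ∀ k, ¬ m k < m i → x i k = 0 := by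
    intro n
    induction n using Nat.strong_induction_on with
    | _ n ih =>
      rintro i rfl k hk
      rw [hxk]
      refine Finset.sum_eq_zero fun v _ => ?_
      by_cases hv : m v.1 < m i
      · have h1 : k ≠ v.1 := by rintro rfl; exact hk hv
        rw [← Prod.mk.eta (p := v), hqk, ih _ hv v.1 rfl k (by omega), if_neg h1]
        simp
      · rw [hzero i v hv, zero_mul]
  have hsum : ∀ n i, m i = n → ∀ b, ∑ k, q (i, b) k = ψ (i, b) := by
    intro n
    induction n using Nat.strong_induction_on with
    | _ n ih =>
      rintro i rfl b
      simp only [hqk, Finset.sum_add_distrib, Finset.sum_ite_eq', Finset.mem_univ, if_true]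
      have : ∑ k, x i k = c i := by
        simp only [hxk]
        rw [Finset.sum_comm, ← hc i]
        refine Finset.sum_congr rfl fun v _ => ?_
        rw [← Finset.mul_sum]
        by_cases hv : m v.1 < m i
        · rw [ih _ hv v.1 rfl v.2]
        · rw [hzero i v hv]; simp
      rw [this]; ring
  refine ⟨q, ⟨fun ε => ?_, ?_⟩, fun v => hsum _ v.1 rfl v.2⟩
  -- The coefficient `α i` is the one that makes the affine function `G` below vanish at `(i, ε i)`;
  -- `X i` is the value of `G` at `x i`.
  · obtain ⟨α, hα⟩ := exists_recursive (α := ℝ) m fun i rec =>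
      -(1 + ∑ k, if h : m k < m i then rec k h * x i k else 0) / (ψ (i, ε i) - c i)
    set X : Fin d → ℝ := fun i => 1 + ∑ k, α k * x i k with hX
    have hα' : ∀ i, α i = -X i / (ψ (i, ε i) - c i) := by
      intro i
      rw [hα i, hX]
      congr 3
      refine Finset.sum_congr rfl fun k _ => ?_
      split_ifs with h
      · rfl
      · rw [hsupp _ i rfl k h, mul_zero]
    set G : CrossVertex d → ℝ := fun v => ∑ k, α k * q v k + 1 with hG
    have hGib : ∀ i b, G (i, b) = X i + α i * (ψ (i, b) - c i) := by
      intro i b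
      simp only [hG, hX, hqk, mul_add, Finset.sum_add_distrib, mul_ite, mul_zero,
        Finset.sum_ite_eq', Finset.mem_univ, if_true]
      ring
    have hG0 : ∀ i, G (i, ε i) = 0 := by
      intro i
      have h1 : ψ (i, ε i) - c i ≠ 0 := fun h => by
        have := hopp i (ε i); rw [h, zero_mul] at this; exact lt_irrefl _ this
      rw [hGib, hα', div_mul_cancel₀ _ h1]; ring
    have hG1 : ∀ i, 0 < X i → 0 < G (i, !ε i) := by
      intro i hi
      have h0 := hopp i (ε i)
      have h1 : ψ (i, ε i) - c i ≠ 0 := fun h => by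
        rw [h, zero_mul] at h0; exact lt_irrefl _ h0
      have h2 : (ψ (i, !ε i) - c i) / (ψ (i, ε i) - c i) < 0 := by
        rw [div_eq_mul_inv, mul_comm]
        have h3 : 0 < ((ψ (i, ε i) - c i)⁻¹) ^ 2 := by positivity
        have h4 : (ψ (i, ε i) - c i)⁻¹ * (ψ (i, !ε i) - c i) =
          ((ψ (i, ε i) - c i) * (ψ (i, !ε i) - c i)) * ((ψ (i, ε i) - c i)⁻¹) ^ 2 := by
          field_simp
        rw [h4]
        exact mul_neg_of_neg_of_pos h0 h3
      have h5 : G (i, !ε i) = X i * (1 - (ψ (i, !ε i) - c i) / (ψ (i, ε i) - c i)) := by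
        rw [hGib, hα']; ring
      rw [h5]
      exact mul_pos hi (by linarith)
    have hbool : ∀ (v : CrossVertex d), v.2 ≠ ε v.1 → v = (v.1, !ε v.1) := by
      rintro ⟨i, b⟩ h
      simp only at h
      rw [← Bool.eq_not_of_ne h]
    -- `X i` is a positively weighted mean of earlier values of `G`, some of them positive; for the
    -- first pair it is the constant term 1. As `x i` is inside the segment, `G` is then positive at
    -- the other end.
    have hXpos : ∀ n i, m i = n → 0 < X i := by
      intro n
      induction n using Nat.strong_induction_on with
      | _ n ih =>
        rintro i rfl
        have hnn : ∀ v, 0 ≤ W i v * G v := by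
          intro v
          by_cases hv : m v.1 < m i
          · refine mul_nonneg (hpos i v hv).le ?_
            by_cases hb : v.2 = ε v.1
            · rw [← Prod.mk.eta (p := v), hb, hG0]
            · rw [hbool v hb]; exact (hG1 _ (ih _ hv _ rfl)).le
          · rw [hzero i v hv, zero_mul]
        by_cases hpred : ∃ j, m j < m i
        · have h1 : X i = ∑ v, W i v * G v := by
            simp only [hX, hG, mul_add, Finset.sum_add_distrib, mul_one, hone i hpred, hxk,
              Finset.mul_sum]
            rw [Finset.sum_comm, add_comm]
            congr 1
            exact Finset.sum_congr rfl fun v _ => Finset.sum_congr rfl fun k _ => by ring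
          rw [h1]
          obtain ⟨j, hj⟩ := hpred
          exact Finset.sum_pos' (fun v _ => hnn v) ⟨(j, !ε j), Finset.mem_univ _,
            mul_pos (hpos i _ hj) (hG1 j (ih _ hj j rfl))⟩
        · have : ∀ k, x i k = 0 := fun k => hsupp _ i rfl k fun h => hpred ⟨k, h⟩
          simp [hX, this]
    refine ⟨G, ⟨∑ k, α k • LinearMap.proj k, 1, fun v => ?_⟩, fun i =>
      ⟨hG0 i, hG1 i (hXpos _ i rfl)⟩⟩
    simp [hG, LinearMap.sum_apply]
  · rintro h ⟨l, c', hl⟩ hnn i hi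
    have hlq : ∀ j b, h (j, b) = (l (x j) + c') + (ψ (j, b) - c j) * l (Pi.single j 1) := by
      intro j b
      rw [hl, hq, map_add, map_smul, smul_eq_mul]; ring
    have hlx : ∀ j, (∃ k, m k < m j) → l (x j) + c' = ∑ v, W j v * h v := by
      intro j hj
      simp only [hl, mul_add, Finset.sum_add_distrib, ← Finset.sum_mul, hone j hj, one_mul]
      simp [hx, map_sum]
    have hcomb : ∀ j, (ψ (j, true) - c j) * h (j, false) - (ψ (j, false) - c j) * h (j, true) =
        (ψ (j, true) - ψ (j, false)) * (l (x j) + c') := by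
      intro j
      rw [hlq, hlq]; ring
    -- Vanishing on the pair `i` gives vanishing at `x i`, a mean of all earlier vertices with
    -- positive weights, hence vanishing at each of them.
    have hdown : ∀ v : CrossVertex d, m v.1 < m i → h v = 0 := by
      intro v hv
      have h1 := hcomb i
      rw [hi, hi, hlx i ⟨_, hv⟩] at h1
      have h2 : ψ (i, true) - ψ (i, false) ≠ 0 := by
        intro h3
        have h4 := hopp i true
        rw [sub_eq_zero.1 h3] at h4
        simp only [Bool.not_true] at h4
        nlinarith [mul_self_nonneg (ψ (i, false) - c i)]
      have h3 : ∑ v, W i v * h v = 0 := by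
        have : (ψ (i, true) - ψ (i, false)) * ∑ v, W i v * h v = 0 := by rw [← h1]; ring
        exact (mul_eq_zero.1 this).resolve_left h2
      rw [Finset.sum_eq_zero_iff_of_nonneg] at h3
      · exact (mul_eq_zero.1 (h3 v (Finset.mem_univ _))).resolve_left (hpos i v hv).ne'
      · intro u _
        by_cases hu : m u.1 < m i
        · exact mul_nonneg (hpos i u hu).le (hnn u)
        · rw [hzero i u hu, zero_mul]
    -- Upwards: if all earlier vertices are zeros, so is `x j`, and a nonnegative affine function
    -- vanishing inside a segment vanishes at both ends.
    have hall : ∀ n j, m j = n → ∀ b, h (j, b) = 0 := by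
      intro n
      induction n using Nat.strong_induction_on with
      | _ n ih =>
        rintro j rfl
        rcases lt_trichotomy (m j) (m i) with hlt | heq | hgt
        · exact fun b => hdown _ hlt
        · rw [hm heq]; exact hi
        · have h0 : l (x j) + c' = 0 := by
            rw [hlx j ⟨i, hgt⟩]
            refine Finset.sum_eq_zero fun v _ => ?_
            by_cases hv : m v.1 < m j
            · rw [← Prod.mk.eta (p := v), ih _ hv v.1 rfl, mul_zero]
            · rw [hzero j v hv, zero_mul]
          have h1 := hcomb j
          rw [h0, mul_zero] at h1
          have h2 := hopp j true
          have h3 := hnn (j, true)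
          have h4 := hnn (j, false)
          simp only [Bool.not_true] at h2
          set A := ψ (j, true) - c j
          set B := ψ (j, false) - c j
          have hA : A ≠ 0 := by rintro hA; rw [hA] at h2; simp at h2
          have hB : B ≠ 0 := by rintro hB; rw [hB] at h2; simp at h2
          have h5 : A * A * h (j, false) = A * B * h (j, true) := by linear_combination A * h1
          have h6 : 0 ≤ A * A * h (j, false) := mul_nonneg (mul_self_nonneg A) h4
          have h7 : A * B * h (j, true) ≤ 0 := mul_nonpos_of_nonpos_of_nonneg h2.le h3
          have h8 : A * A * h (j, false) = 0 := by linarith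
          have h9 : A * B * h (j, true) = 0 := by linarith
          rintro (b | b)
          · simpa [hA] using h8
          · simpa [hA, hB] using h9
    exact fun v => hall _ v.1 rfl v.2

/-! ### Topological orders, labelings and signed permutations. -/

theorem exists_topologicalOrder {α : Type*} [Fintype α] (r : α → α → Prop)
    (hr : ∀ a, ¬ Relation.TransGen r a a) :
    ∃ f : α ≃ Fin (Fintype.card α), ∀ a b, r a b → f a < f b := by
  classical
  have hpo : IsPartialOrder α (Relation.ReflTransGen r) :=
    { refl := fun _ => Relation.ReflTransGen.refl
      trans := fun _ _ _ => Relation.ReflTransGen.trans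
      antisymm := fun a b hab hba => by
        rcases Relation.reflTransGen_iff_eq_or_transGen.1 hab with h | h
        · exact h.symm
        · exact absurd (h.trans_left hba) (hr a) }
  obtain ⟨s, hs, hle⟩ := extend_partialOrder (Relation.ReflTransGen r)
  let _ : LinearOrder α :=
    { le := s
      le_refl := hs.refl
      le_trans := hs.trans
      le_antisymm := hs.antisymm
      le_total := hs.total
      toDecidableLE := Classical.decRel _ }
  let e : Fin (Fintype.card α) ≃o α := Fintype.orderIsoFinOfCardEq α rfl
  refine ⟨e.symm.toEquiv, fun a b hab => ?_⟩
  have h1 : a ≤ b := hle a b (Relation.ReflTransGen.single hab)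
  have h2 : a ≠ b := by rintro rfl; exact hr a (Relation.TransGen.single hab)
  exact e.symm.lt_iff_lt.2 (lt_of_le_of_ne h1 h2)

/-- The shift `Fin n ≃ {1, …, n}`. -/
def finEquivIcc (n : ℕ) : Fin n ≃ Finset.Icc 1 n where
  toFun i := ⟨i + 1, by rw [Finset.mem_Icc]; omega⟩
  invFun x := ⟨x - 1, by have := Finset.mem_Icc.1 x.2; omega⟩
  left_inv i := by simp
  right_inv x := by have := Finset.mem_Icc.1 x.2; ext; simp; omega

namespace CrossLabeling

variable {d : ℕ} (lab : CrossLabeling d)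

theorem one_le (v : CrossVertex d) : 1 ≤ (lab v : ℕ) := (Finset.mem_Icc.1 (lab v).2).1

theorem le (v : CrossVertex d) : (lab v : ℕ) ≤ 2 * d := (Finset.mem_Icc.1 (lab v).2).2

theorem val_inj {v w : CrossVertex d} : (lab v : ℕ) = lab w ↔ v = w := by
  rw [Subtype.coe_inj, lab.apply_eq_iff_eq]

theorem ne (i : Fin d) : (lab (i, true) : ℕ) ≠ lab (i, false) := by
  rw [Ne, val_inj]; simp

theorem exists_eq {n : ℕ} (h1 : 1 ≤ n) (h2 : n ≤ 2 * d) : ∃ v, (lab v : ℕ) = n :=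
  ⟨lab.symm ⟨n, Finset.mem_Icc.2 ⟨h1, h2⟩⟩, by simp⟩

/-- The pair of labels of the `i`-th pair of vertices. -/
def pairOf (i : Fin d) : Finset ℕ := {(lab (i, true) : ℕ), (lab (i, false) : ℕ)}

theorem pairs_eq : lab.pairs = Finset.univ.image lab.pairOf := rfl

theorem mem_pairOf {i : Fin d} {n : ℕ} : n ∈ lab.pairOf i ↔ ∃ b, (lab (i, b) : ℕ) = n := by
  simp [pairOf, or_comm, eq_comm]

theorem val_mem_pairOf {i : Fin d} {v : CrossVertex d} :
    (lab v : ℕ) ∈ lab.pairOf i ↔ v.1 = i := by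
  rw [mem_pairOf]
  constructor
  · rintro ⟨b, hb⟩
    rw [val_inj] at hb
    rw [← hb]
  · rintro rfl
    exact ⟨v.2, rfl⟩

theorem pairOf_injective : Function.Injective lab.pairOf := by
  intro i j h
  have : (lab (i, true) : ℕ) ∈ lab.pairOf j := by rw [← h, val_mem_pairOf]
  exact lab.val_mem_pairOf.1 this

theorem pairs_mem_pairSequences : lab.pairs ∈ pairSequences d := by
  rw [pairSequences, Finset.mem_filter, Finset.mem_powerset]
  refine ⟨?_, ?_, ?_⟩
  · intro p hp
    rw [pairs_eq, Finset.mem_image] at hp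
    obtain ⟨i, -, rfl⟩ := hp
    rw [Finset.mem_powersetCard]
    refine ⟨fun n hn => ?_, Finset.card_pair (lab.ne i)⟩
    obtain ⟨b, rfl⟩ := lab.mem_pairOf.1 hn
    exact (lab _).2
  · intro p hp p' hp' hne
    rw [pairs_eq, Finset.mem_image] at hp hp'
    obtain ⟨i, -, rfl⟩ := hp
    obtain ⟨j, -, rfl⟩ := hp'
    rw [Finset.disjoint_left]
    intro n hn hn'
    obtain ⟨b, rfl⟩ := lab.mem_pairOf.1 hn
    rw [val_mem_pairOf] at hn'
    exact hne (by rw [← hn'])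
  · ext n
    simp only [Finset.mem_biUnion, pairs_eq, Finset.mem_image, Finset.mem_univ, true_and, id]
    constructor
    · rintro ⟨_, ⟨i, rfl⟩, hn⟩
      obtain ⟨b, rfl⟩ := lab.mem_pairOf.1 hn
      exact (lab _).2
    · intro hn
      obtain ⟨v, rfl⟩ := lab.exists_eq (Finset.mem_Icc.1 hn).1 (Finset.mem_Icc.1 hn).2
      exact ⟨_, ⟨v.1, rfl⟩, lab.val_mem_pairOf.2 rfl⟩

end CrossLabeling

theorem mem_pairSequences {d : ℕ} {π : Finset (Finset ℕ)} :
    π ∈ pairSequences d ↔ (∀ p ∈ π, p.card = 2) ∧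
      (∀ p ∈ π, ∀ q ∈ π, p ≠ q → Disjoint p q) ∧ π.biUnion id = Finset.Icc 1 (2 * d) := by
  rw [pairSequences, Finset.mem_filter, Finset.mem_powerset]
  constructor
  · exact fun h => ⟨fun p hp => (Finset.mem_powersetCard.1 (h.1 hp)).2, h.2⟩
  · refine fun h => ⟨fun p hp => Finset.mem_powersetCard.2 ⟨?_, h.1 p hp⟩, h.2⟩
    rw [← h.2.2]
    exact Finset.subset_biUnion_of_mem id hp

theorem card_of_mem_pairSequences {d : ℕ} {π : Finset (Finset ℕ)} (h : π ∈ pairSequences d) :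
    π.card = d := by
  obtain ⟨h1, h2, h3⟩ := mem_pairSequences.1 h
  have := Finset.card_biUnion (s := π) (t := id) fun p hp q hq hne => h2 p hp q hq hne
  rw [h3, Finset.sum_const_nat (m := 2) (f := fun p => (id p).card) fun p hp => h1 p hp,
    Nat.card_Icc] at this
  omega

theorem exists_labeling {d : ℕ} {π : Finset (Finset ℕ)} (h : π ∈ pairSequences d) :
    ∃ lab : CrossLabeling d, lab.pairs = π ∧
      ∀ i, (lab (i, true) : ℕ) < lab (i, false) := by
  classical
  obtain ⟨h1, h2, h3⟩ := mem_pairSequences.1 h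
  let e : Fin d ≃ π := (finCongr (card_of_mem_pairSequences h).symm).trans π.equivFin.symm
  have hpair : ∀ p : π, ∃ a b : ℕ, a < b ∧ (p : Finset ℕ) = {a, b} := by
    intro p
    obtain ⟨a, b, hne, hp⟩ := Finset.card_eq_two.1 (h1 p p.2)
    rcases lt_or_gt_of_ne hne with hlt | hlt
    · exact ⟨a, b, hlt, hp⟩
    · exact ⟨b, a, hlt, by rw [hp, Finset.pair_comm]⟩
  choose a b hab hp using hpair
  let F : CrossVertex d → ℕ := fun v => if v.2 then a (e v.1) else b (e v.1)
  have hF : ∀ v, F v ∈ (e v.1 : Finset ℕ) := by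
    rintro ⟨i, c⟩
    rw [hp]
    cases c <;> simp [F]
  have hFmem : ∀ v, F v ∈ Finset.Icc 1 (2 * d) := by
    intro v
    rw [← h3]
    exact Finset.mem_biUnion.2 ⟨_, (e v.1).2, hF v⟩
  have hinj : Function.Injective fun v => (⟨F v, hFmem v⟩ : Finset.Icc 1 (2 * d)) := by
    rintro ⟨i, c⟩ ⟨j, c'⟩ hij
    have hij' : F (i, c) = F (j, c') := congrArg Subtype.val hij
    have hEq : i = j := by
      by_contra hne
      have hne' : (e i : Finset ℕ) ≠ e j := fun he => hne (e.injective (Subtype.ext he))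
      exact Finset.disjoint_left.1 (h2 _ (e i).2 _ (e j).2 hne') (hF (i, c))
        (hij' ▸ hF (j, c'))
    subst hEq
    have := hab (e i)
    cases c <;> cases c' <;> simp [F] at hij' ⊢ <;> omega
  have hbij : Function.Bijective fun v => (⟨F v, hFmem v⟩ : Finset.Icc 1 (2 * d)) := by
    rw [Fintype.bijective_iff_injective_and_card]
    refine ⟨hinj, ?_⟩
    simp; ring
  refine ⟨Equiv.ofBijective _ hbij, ?_, fun i => by simpa [F] using hab (e i)⟩
  ext p
  simp only [CrossLabeling.pairs, Finset.mem_image, Finset.mem_univ, true_and,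
    Equiv.ofBijective_apply]
  constructor
  · rintro ⟨i, rfl⟩
    have : (e i : Finset ℕ) = {F (i, true), F (i, false)} := by rw [hp]; simp [F]
    rw [← this]
    exact (e i).2
  · intro hpm
    refine ⟨e.symm ⟨p, hpm⟩, ?_⟩
    have := hp ⟨p, hpm⟩
    simp only at this
    simp [F, ← this]

/-- The permutation of the vertices of the crosspolytope which permutes the antipodal pairs by `ρ`
and then switches the vertices of the pairs given by `ε`. -/
def signedPerm {d : ℕ} (ρ : Equiv.Perm (Fin d)) (ε : Fin d → Bool) :
    Equiv.Perm (CrossVertex d) where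
  toFun v := (ρ v.1, xor v.2 (ε (ρ v.1)))
  invFun v := (ρ.symm v.1, xor v.2 (ε v.1))
  left_inv v := by simp
  right_inv v := by simp

namespace CrossLabeling

variable {d : ℕ} (lab : CrossLabeling d)

/-- The labeling obtained by a signed permutation of the vertices. -/
def relabel (x : Equiv.Perm (Fin d) × (Fin d → Bool)) : CrossLabeling d :=
  (signedPerm x.1 x.2).trans lab

theorem relabel_apply (x : Equiv.Perm (Fin d) × (Fin d → Bool)) (i : Fin d) (b : Bool) :
    lab.relabel x (i, b) = lab (x.1 i, xor b (x.2 (x.1 i))) := rfl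

theorem pairOf_relabel (x : Equiv.Perm (Fin d) × (Fin d → Bool)) (i : Fin d) :
    (lab.relabel x).pairOf i = lab.pairOf (x.1 i) := by
  unfold pairOf
  rw [relabel_apply, relabel_apply]
  cases x.2 (x.1 i) <;> simp [Finset.pair_comm]

theorem pairs_relabel (x : Equiv.Perm (Fin d) × (Fin d → Bool)) :
    (lab.relabel x).pairs = lab.pairs := by
  rw [pairs_eq, pairs_eq]
  ext p
  simp only [Finset.mem_image, Finset.mem_univ, true_and, pairOf_relabel]
  exact ⟨fun ⟨i, h⟩ => ⟨_, h⟩, fun ⟨i, h⟩ => ⟨x.1.symm i, by simpa using h⟩⟩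

theorem relabel_injective : Function.Injective lab.relabel := by
  rintro ⟨ρ, ε⟩ ⟨ρ', ε'⟩ h
  have h1 : ∀ i b, (ρ i, xor b (ε (ρ i))) = (ρ' i, xor b (ε' (ρ' i))) := fun i b =>
    lab.injective (DFunLike.congr_fun h (i, b))
  have h2 : ρ = ρ' := Equiv.ext fun i => congrArg Prod.fst (h1 i false)
  subst h2
  refine Prod.ext rfl (funext fun j => ?_)
  have := congrArg Prod.snd (h1 (ρ.symm j) false)
  simpa using this

theorem exists_relabel_eq {lab' : CrossLabeling d} (h : lab'.pairs = lab.pairs) :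
    ∃ x, lab.relabel x = lab' := by
  have hex : ∀ i, ∃ j, lab.pairOf j = lab'.pairOf i := by
    intro i
    have : lab'.pairOf i ∈ lab.pairs := by
      rw [← h, pairs_eq]; exact Finset.mem_image_of_mem _ (Finset.mem_univ _)
    rw [pairs_eq, Finset.mem_image] at this
    obtain ⟨j, -, hj⟩ := this
    exact ⟨j, hj⟩
  choose r hr using hex
  have hinj : Function.Injective r := fun i j hij =>
    lab'.pairOf_injective (by rw [← hr, ← hr, hij])
  let ρ : Equiv.Perm (Fin d) := Equiv.ofBijective r (Finite.injective_iff_bijective.1 hinj)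
  have hb : ∀ i c, ∃ b, (lab (r i, b) : ℕ) = lab' (i, c) := fun i c =>
    lab.mem_pairOf.1 (by rw [hr, val_mem_pairOf])
  choose β hβ using hb
  refine ⟨(ρ, fun j => β (ρ.symm j) false), ?_⟩
  ext ⟨i, c⟩
  rw [relabel_apply]
  simp only [Equiv.symm_apply_apply]
  change (lab (r i, _) : ℕ) = _
  rw [← hβ]
  congr 3
  have hne : β i true ≠ β i false := by
    intro he
    have h1 := hβ i true
    rw [he, hβ i false] at h1
    exact lab'.ne i h1.symm
  revert hne
  cases c <;> cases β i true <;> cases β i false <;> simp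

/-- The signed permutations act freely (`relabel_injective`) and transitively (`exists_relabel_eq`)
on these labelings. -/
theorem card_pairs_eq :
    Nat.card {lab' : CrossLabeling d // lab'.pairs = lab.pairs} = 2 ^ d * d ! := by
  have : Nat.card {lab' : CrossLabeling d // lab'.pairs = lab.pairs} =
      Nat.card (Equiv.Perm (Fin d) × (Fin d → Bool)) := by
    refine (Nat.card_eq_of_bijective (fun x => ⟨lab.relabel x, lab.pairs_relabel x⟩) ⟨?_, ?_⟩).symm
    · exact fun x y h => lab.relabel_injective (congrArg Subtype.val h)
    · rintro ⟨lab', h⟩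
      obtain ⟨x, hx⟩ := lab.exists_relabel_eq h
      exact ⟨x, Subtype.ext hx⟩
  rw [this, Nat.card_prod]
  simp [Fintype.card_perm, mul_comm]

/-- In every pair of vertices with consecutive labels, `(i, true)` has the smaller label. -/
def IsCanonical : Prop := ∀ i, (lab (i, false) : ℕ) + 1 ≠ lab (i, true)

theorem numConsecutive_pairs (hlt : ∀ i, (lab (i, true) : ℕ) < lab (i, false)) :
    numConsecutive lab.pairs =
      (Finset.univ.filter fun i => (lab (i, true) : ℕ) + 1 = lab (i, false)).card := by
  rw [numConsecutive, pairs_eq, Finset.filter_image,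
    Finset.card_image_of_injective _ lab.pairOf_injective]
  congr 1
  ext i
  have := hlt i
  simp only [Finset.mem_filter, Finset.mem_univ, true_and, pairOf, Finset.mem_insert,
    Finset.mem_singleton, exists_eq_or_imp, exists_eq_left]
  omega

/-- In a consecutive pair only one of the two switches is canonical; in every other pair both are.
The set `A` below consists of the allowed switches. -/
theorem card_canonical (hlt : ∀ i, (lab (i, true) : ℕ) < lab (i, false)) :
    Nat.card {lab' : CrossLabeling d // lab'.pairs = lab.pairs ∧ lab'.IsCanonical} =
      2 ^ (d - numConsecutive lab.pairs) * d ! := by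
  classical
  let A : Finset (Fin d → Bool) := Fintype.piFinset fun i =>
    if (lab (i, true) : ℕ) + 1 = lab (i, false) then {false} else Finset.univ
  have hA : ∀ ε, ε ∈ A ↔ ∀ i, (lab (i, true) : ℕ) + 1 = lab (i, false) → ε i = false := by
    intro ε
    simp only [A, Fintype.mem_piFinset]
    refine forall_congr' fun i => ?_
    split_ifs with h <;> simp [h]
  have hcan : ∀ x, (lab.relabel x).IsCanonical ↔ x.2 ∈ A := by
    intro x
    rw [hA, IsCanonical]
    refine x.1.forall_congr fun i => ?_
    have := hlt (x.1 i)
    rw [relabel_apply, relabel_apply]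
    cases x.2 (x.1 i) <;> simp <;> omega
  have : Nat.card {lab' : CrossLabeling d // lab'.pairs = lab.pairs ∧ lab'.IsCanonical} =
      Nat.card (Equiv.Perm (Fin d) × A) := by
    refine (Nat.card_eq_of_bijective
      (fun x => ⟨lab.relabel (x.1, x.2.1), lab.pairs_relabel _, (hcan _).2 x.2.2⟩) ⟨?_, ?_⟩).symm
    · rintro ⟨ρ, ε⟩ ⟨ρ', ε'⟩ h
      have := lab.relabel_injective (congrArg Subtype.val h)
      simp only [Prod.mk.injEq] at this
      exact Prod.ext this.1 (Subtype.ext this.2)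
    · rintro ⟨lab', h, hc⟩
      obtain ⟨x, rfl⟩ := lab.exists_relabel_eq h
      exact ⟨(x.1, ⟨x.2, (hcan x).1 hc⟩), rfl⟩
  rw [this, Nat.card_prod, mul_comm, lab.numConsecutive_pairs hlt]
  congr 1
  · rw [Nat.card_eq_fintype_card, Fintype.card_coe]
    simp only [A, Fintype.card_piFinset, apply_ite Finset.card, Finset.card_singleton,
      Finset.card_univ, Fintype.card_bool]
    rw [Finset.prod_ite]
    simp only [Finset.prod_const_one, Finset.prod_const, one_mul]
    congr 1
    have := Finset.card_filter_add_card_filter_not (s := (Finset.univ : Finset (Fin d)))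
      fun i => (lab (i, true) : ℕ) + 1 = lab (i, false)
    rw [Finset.card_univ, Fintype.card_fin] at this
    omega
  · simp [Nat.card_eq_fintype_card, Fintype.card_perm]

/-- The orientation of the edges of the crosspolytope towards the larger label. -/
def orientation : CrossOrientation d where
  arc v w := (polyGraph (crosspolytope d)).Adj v w ∧ (lab v : ℕ) < lab w
  arc_or_arc_iff v w := by
    constructor
    · rintro (h | h)
      · exact h.1
      · exact h.1.symm
    · intro h
      rcases lt_or_gt_of_ne (fun he => h.ne (lab.val_inj.1 he)) with hlt | hlt
      · exact Or.inl ⟨h, hlt⟩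
      · exact Or.inr ⟨h.symm, hlt⟩
  asymm v w h h' := lt_asymm h.2 h'.2

theorem orientation_isLabeledBy : lab.orientation.IsLabeledBy lab := fun _ _ h => h.2

end CrossLabeling

/-! ### The labelings of a given orientation. -/

namespace CrossOrientation

variable {d : ℕ} {O : CrossOrientation d} {lab lab' : CrossLabeling d}

theorem IsLabeledBy.isAcyclic (h : O.IsLabeledBy lab) : O.IsAcyclic := by
  have key : ∀ v w, Relation.TransGen O.arc v w → (lab v : ℕ) < lab w := by
    intro v w hvw
    induction hvw with
    | single hvw => exact h _ _ hvw
    | tail _ hvw ih => exact ih.trans (h _ _ hvw)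
  exact fun v hv => lt_irrefl _ (key v v hv)

theorem IsLabeledBy.arc_iff (h : O.IsLabeledBy lab) {v w : CrossVertex d} :
    O.arc v w ↔ (polyGraph (crosspolytope d)).Adj v w ∧ (lab v : ℕ) < lab w := by
  constructor
  · exact fun hvw => ⟨(O.arc_or_arc_iff v w).1 (Or.inl hvw), h v w hvw⟩
  · rintro ⟨hadj, hlt⟩
    rcases (O.arc_or_arc_iff v w).2 hadj with h' | h'
    · exact h'
    · exact absurd (h _ _ h') (not_lt.2 hlt.le)

theorem IsLabeledBy.eq_orientation (h : O.IsLabeledBy lab) : O = lab.orientation := by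
  ext v w
  exact h.arc_iff

theorem exists_isLabeledBy (hO : O.IsAcyclic) : ∃ lab : CrossLabeling d, O.IsLabeledBy lab := by
  obtain ⟨f, hf⟩ := exists_topologicalOrder O.arc hO
  have hcard : Fintype.card (CrossVertex d) = 2 * d := by simp; ring
  refine ⟨f.trans ((finCongr hcard).trans (finEquivIcc _)), fun v w h => ?_⟩
  have := hf v w h
  simpa [finEquivIcc] using this

/-- The vertices with smaller label are the in-neighbours of `v` and possibly its antipode, the only
vertex not adjacent to `v`. -/
theorem IsLabeledBy.label_eq (hd : 2 ≤ d) (h : O.IsLabeledBy lab) (v : CrossVertex d) :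
    (lab v : ℕ) = 1 + {w | O.arc w v}.ncard +
      if (lab (v.1, !v.2) : ℕ) < lab v then 1 else 0 := by
  classical
  have h1 : {w | (lab w : ℕ) < lab v}.ncard = lab v - 1 := by
    have himg : (fun w => (lab w : ℕ)) '' {w | (lab w : ℕ) < lab v} =
        (Finset.Ico 1 (lab v : ℕ) : Finset ℕ) := by
      ext n
      simp only [Set.mem_image, Set.mem_ofPred_eq, Finset.coe_Ico, Set.mem_Ico]
      constructor
      · rintro ⟨w, hw, rfl⟩
        exact ⟨lab.one_le w, hw⟩
      · rintro ⟨hn1, hn2⟩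
        obtain ⟨w, rfl⟩ := lab.exists_eq hn1 (hn2.le.trans (lab.le v))
        exact ⟨w, hn2, rfl⟩
    rw [← Set.ncard_image_of_injective _ (fun a b hab => lab.val_inj.1 hab), himg,
      Set.ncard_coe_finset, Nat.card_Ico]
  have h2 : {w | (lab w : ℕ) < lab v} = {w | O.arc w v} ∪
      {w | w = (v.1, !v.2) ∧ (lab w : ℕ) < lab v} := by
    ext w
    simp only [Set.mem_ofPred_eq, Set.mem_union, h.arc_iff, crosspolytope_adj hd]
    constructor
    · intro hlt
      by_cases he : w.1 = v.1
      · refine Or.inr ⟨?_, hlt⟩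
        have : w.2 ≠ v.2 := fun hc => by rw [Prod.ext he hc] at hlt; exact lt_irrefl _ hlt
        exact Prod.ext he (Bool.eq_not_of_ne this)
      · exact Or.inl ⟨he, hlt⟩
    · rintro (hw | hw) <;> exact hw.2
  have h3 : Disjoint {w | O.arc w v} {w | w = (v.1, !v.2) ∧ (lab w : ℕ) < lab v} := by
    rw [Set.disjoint_left]
    rintro w hw ⟨rfl, -⟩
    have := (h.arc_iff.1 hw).1
    rw [crosspolytope_adj hd] at this
    exact this rfl
  have h4 : {w | w = (v.1, !v.2) ∧ (lab w : ℕ) < lab v}.ncard =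
      if (lab (v.1, !v.2) : ℕ) < lab v then 1 else 0 := by
    split_ifs with hlt
    · rw [Set.ncard_eq_one]
      refine ⟨(v.1, !v.2), ?_⟩
      ext w
      simp only [Set.mem_ofPred_eq, Set.mem_singleton_iff, and_iff_left_iff_imp]
      rintro rfl
      exact hlt
    · rw [Set.ncard_eq_zero (Set.toFinite _), Set.eq_empty_iff_forall_notMem]
      rintro w ⟨rfl, hw⟩
      exact hlt hw
  rw [h2, Set.ncard_union_eq h3 (Set.toFinite _) (Set.toFinite _), h4] at h1
  have := lab.one_le v
  omega

/-- By `label_eq`, if the in-degrees of two antipodes differ, the one with smaller in-degree comes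
first. If they agree, the labels are consecutive, and exchanging them does not change the pair. -/
theorem IsLabeledBy.pairs_eq (hd : 2 ≤ d) (h : O.IsLabeledBy lab) (h' : O.IsLabeledBy lab') :
    lab.pairs = lab'.pairs := by
  unfold CrossLabeling.pairs
  congr 1
  ext i : 1
  have h1 := h.label_eq hd (i, true)
  have h2 := h.label_eq hd (i, false)
  have h3 := h'.label_eq hd (i, true)
  have h4 := h'.label_eq hd (i, false)
  simp only [Bool.not_true, Bool.not_false] at h1 h2 h3 h4
  have : ((lab (i, true) : ℕ) = lab' (i, true) ∧ (lab (i, false) : ℕ) = lab' (i, false)) ∨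
      ((lab (i, true) : ℕ) = lab' (i, false) ∧ (lab (i, false) : ℕ) = lab' (i, true)) := by
    have := lab.ne i
    have := lab'.ne i
    split_ifs at h1 h2 h3 h4 <;> omega
  rcases this with ⟨e1, e2⟩ | ⟨e1, e2⟩
  · rw [e1, e2]
  · rw [e1, e2, Finset.pair_comm]

theorem IsLabeledBy.eq_of_isCanonical (hd : 2 ≤ d) (h : O.IsLabeledBy lab)
    (h' : O.IsLabeledBy lab') (hc : lab.IsCanonical) (hc' : lab'.IsCanonical) : lab = lab' := by
  ext ⟨i, b⟩
  have h1 := h.label_eq hd (i, true)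
  have h2 := h.label_eq hd (i, false)
  have h3 := h'.label_eq hd (i, true)
  have h4 := h'.label_eq hd (i, false)
  simp only [Bool.not_true, Bool.not_false] at h1 h2 h3 h4
  have := lab.ne i
  have := lab'.ne i
  have := hc i
  have := hc' i
  cases b <;> split_ifs at h1 h2 h3 h4 <;> omega

/-- Switching consecutive labels within a pair preserves their comparison with every other label,
and the two vertices themselves are not adjacent. -/
theorem IsLabeledBy.exists_isCanonical (hd : 2 ≤ d) (h : O.IsLabeledBy lab) :
    ∃ lab' : CrossLabeling d, O.IsLabeledBy lab' ∧ lab'.pairs = lab.pairs ∧ lab'.IsCanonical := by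
  let ε : Fin d → Bool := fun j => decide ((lab (j, false) : ℕ) + 1 = lab (j, true))
  have hε : ∀ j, (ε j = true ∧ (lab (j, false) : ℕ) + 1 = lab (j, true)) ∨
      (ε j = false ∧ (lab (j, false) : ℕ) + 1 ≠ lab (j, true)) := by
    intro j
    by_cases hj : (lab (j, false) : ℕ) + 1 = lab (j, true) <;> simp [ε, hj]
  refine ⟨lab.relabel (1, ε), ?_, lab.pairs_relabel _, ?_⟩
  · rintro ⟨i, b⟩ ⟨j, c⟩ hvw
    obtain ⟨hadj, hlt⟩ := h.arc_iff.1 hvw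
    rw [crosspolytope_adj hd] at hadj
    have hij : i ≠ j := hadj
    have hne : ∀ b c, (lab (i, b) : ℕ) ≠ lab (j, c) := fun b c he =>
      hij (congrArg Prod.fst (lab.val_inj.1 he))
    have n1 := hne true true
    have n2 := hne true false
    have n3 := hne false true
    have n4 := hne false false
    rw [CrossLabeling.relabel_apply, CrossLabeling.relabel_apply]
    simp only [Equiv.Perm.coe_one, id]
    rcases hε i with ⟨e1, e2⟩ | ⟨e1, e2⟩ <;> rcases hε j with ⟨e3, e4⟩ | ⟨e3, e4⟩ <;>
      rw [e1, e3] <;> cases b <;> cases c <;>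
      simp only [Bool.xor_true, Bool.xor_false, Bool.not_true, Bool.not_false] <;> omega
  · intro i
    rw [CrossLabeling.relabel_apply, CrossLabeling.relabel_apply]
    simp only [Equiv.Perm.coe_one, id]
    rcases hε i with ⟨e1, e2⟩ | ⟨e1, e2⟩ <;> rw [e1] <;>
      simp only [Bool.xor_true, Bool.xor_false, Bool.not_true, Bool.not_false] <;> omega

end CrossOrientation

/-! ### Counting pair sequences; splits and the recursion. -/

theorem card_labelings_filter {d : ℕ} {π : Finset (Finset ℕ)} (h : π ∈ pairSequences d) :
    (Finset.univ.filter fun lab : CrossLabeling d => lab.pairs = π).card = 2 ^ d * d ! := by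
  obtain ⟨lab, rfl, -⟩ := exists_labeling h
  rw [← lab.card_pairs_eq, Nat.card_eq_fintype_card, Fintype.card_subtype]

/-- There are `(2d)!` labelings, falling into classes of size `2^d d!` according to their pair
sequence. -/
theorem card_pairSequences (d : ℕ) : (pairSequences d).card = (2 * d - 1)‼ := by
  have h1 : Fintype.card (CrossLabeling d) = (2 * d)! := by
    have hcard : Fintype.card (CrossVertex d) = 2 * d := by simp; ring
    rw [Fintype.card_equiv
      ((Fintype.equivFin _).trans ((finCongr hcard).trans (finEquivIcc _))), hcard]
  have h2 : Fintype.card (CrossLabeling d) = (pairSequences d).card * (2 ^ d * d !) := by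
    rw [← Finset.card_univ, Finset.card_eq_sum_card_fiberwise (f := CrossLabeling.pairs)
      (t := pairSequences d) fun lab _ => lab.pairs_mem_pairSequences,
      Finset.sum_const_nat fun π hπ => card_labelings_filter hπ]
  have h3 : (2 * d)! = (2 * d - 1)‼ * (2 ^ d * d !) := by
    rcases d with _ | d
    · simp
    · have : 2 * (d + 1) = 2 * d + 1 + 1 := by ring
      rw [← Nat.doubleFactorial_two_mul, this, Nat.factorial_eq_mul_doubleFactorial, mul_comm]
      simp
  have h4 : 0 < 2 ^ d * d ! := by positivity
  exact Nat.eq_of_mul_eq_mul_right h4 (by rw [← h2, h1, h3])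

theorem subset_Icc_of_mem {d : ℕ} {π : Finset (Finset ℕ)} (h : π ∈ pairSequences d)
    {p : Finset ℕ} (hp : p ∈ π) : p ⊆ Finset.Icc 1 (2 * d) := by
  rw [← (mem_pairSequences.1 h).2.2]
  exact Finset.subset_biUnion_of_mem id hp

theorem nonempty_of_mem {d : ℕ} {π : Finset (Finset ℕ)} (h : π ∈ pairSequences d)
    {p : Finset ℕ} (hp : p ∈ π) : p.Nonempty := by
  rw [← Finset.card_pos, (mem_pairSequences.1 h).1 p hp]; norm_num

theorem exists_mem_of_mem_Icc {d : ℕ} {π : Finset (Finset ℕ)} (h : π ∈ pairSequences d)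
    {n : ℕ} (hn : n ∈ Finset.Icc 1 (2 * d)) : ∃ p ∈ π, n ∈ p := by
  rw [← (mem_pairSequences.1 h).2.2] at hn
  simpa using hn

/-- No pair of `π` has both an element in `{1, …, 2k}` and an element outside. -/
def SplitsAt (π : Finset (Finset ℕ)) (k : ℕ) : Prop :=
  ∀ p ∈ π, p ⊆ Finset.Icc 1 (2 * k) ∨ Disjoint p (Finset.Icc 1 (2 * k))

theorem splitsAt_zero (π : Finset (Finset ℕ)) : SplitsAt π 0 := fun p _ => Or.inr (by simp)

theorem SplitsAt.lower_mem {d k : ℕ} {π : Finset (Finset ℕ)} (h : π ∈ pairSequences d)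
    (hk : k ≤ d) (hs : SplitsAt π k) :
    π.filter (· ⊆ Finset.Icc 1 (2 * k)) ∈ pairSequences k := by
  have h' := mem_pairSequences.1 h
  refine mem_pairSequences.2 ⟨fun p hp => h'.1 p (Finset.mem_filter.1 hp).1,
    fun p hp q hq => h'.2.1 p (Finset.mem_filter.1 hp).1 q (Finset.mem_filter.1 hq).1, ?_⟩
  ext n
  simp only [Finset.mem_biUnion, Finset.mem_filter, id]
  constructor
  · rintro ⟨p, ⟨-, hp⟩, hn⟩
    exact hp hn
  · intro hn
    obtain ⟨p, hp, hnp⟩ := exists_mem_of_mem_Icc h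
      (Finset.Icc_subset_Icc le_rfl (by omega) hn)
    refine ⟨p, ⟨hp, (hs p hp).resolve_right fun hdis => ?_⟩, hnp⟩
    exact Finset.disjoint_left.1 hdis hnp hn

theorem min_lt_min_of_subset {k : ℕ} {p p' : Finset ℕ} (hp : p ⊆ Finset.Icc 1 (2 * k))
    (hne : p.Nonempty) (hne' : p'.Nonempty) (h0 : ∀ n ∈ p', 1 ≤ n)
    (hp' : Disjoint p' (Finset.Icc 1 (2 * k))) : p.min < p'.min := by
  rw [← Finset.coe_min' hne, ← Finset.coe_min' hne', WithTop.coe_lt_coe]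
  have h1 := Finset.mem_Icc.1 (hp (p.min'_mem hne))
  have h2 := h0 _ (p'.min'_mem hne')
  have h3 := Finset.disjoint_left.1 hp' (p'.min'_mem hne')
  rw [Finset.mem_Icc] at h3
  omega

/-- At a split, exactly `k` pairs lie in `{1, …, 2k}`, and their minima precede those of all other
pairs, so they are the first `k` pairs. -/
theorem biUnion_firstPairs_eq_iff {d k : ℕ} {π : Finset (Finset ℕ)} (h : π ∈ pairSequences d)
    (hk : k ≤ d) :
    (firstPairs π k).biUnion id = Finset.Icc 1 (2 * k) ↔ SplitsAt π k := by
  constructor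
  · intro heq p hp
    by_cases hpf : p ∈ firstPairs π k
    · left
      rw [← heq]
      exact Finset.subset_biUnion_of_mem id hpf
    · right
      rw [← heq, Finset.disjoint_biUnion_right]
      intro q hq
      exact (mem_pairSequences.1 h).2.1 p hp q (Finset.mem_filter.1 hq).1
        fun hpq => hpf (hpq ▸ hq)
  · intro hs
    have hA := hs.lower_mem h hk
    have hcard := card_of_mem_pairSequences hA
    have hlt : ∀ p ∈ π, ∀ q ∈ π, p ⊆ Finset.Icc 1 (2 * k) → ¬ q ⊆ Finset.Icc 1 (2 * k) →
        p.min < q.min := fun p hp q hq hp' hq' =>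
      min_lt_min_of_subset hp' (nonempty_of_mem h hp) (nonempty_of_mem h hq)
        (fun n hn => (Finset.mem_Icc.1 (subset_Icc_of_mem h hq hn)).1)
        ((hs q hq).resolve_left hq')
    have : firstPairs π k = π.filter (· ⊆ Finset.Icc 1 (2 * k)) := by
      unfold firstPairs
      refine Finset.filter_congr fun p hp => ?_
      constructor
      · intro hc
        by_contra hp'
        refine absurd hc (not_lt.2 ?_)
        conv_lhs => rw [← hcard]
        refine Finset.card_le_card fun q hq => ?_
        rw [Finset.mem_filter] at hq ⊢
        exact ⟨hq.1, hlt q hq.1 p hp hq.2 hp'⟩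
      · intro hp'
        conv_rhs => rw [← hcard]
        refine Finset.card_lt_card (Finset.ssubset_iff_of_subset ?_ |>.2 ⟨p, ?_, ?_⟩)
        · intro q hq
          rw [Finset.mem_filter] at hq ⊢
          refine ⟨hq.1, ?_⟩
          by_contra hq'
          exact lt_asymm hq.2 (hlt p hp q hq.1 hp' hq')
        · exact Finset.mem_filter.2 ⟨hp, hp'⟩
        · simp
    rw [this]
    exact (mem_pairSequences.1 hA).2.2

theorem isGoodPairSequence_iff {d : ℕ} {π : Finset (Finset ℕ)} (h : π ∈ pairSequences d) :
    IsGoodPairSequence d π ↔ ∀ k < d, 0 < k → ¬ SplitsAt π k := by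
  unfold IsGoodPairSequence
  refine forall_congr' fun k => forall_congr' fun hk => forall_congr' fun _ => ?_
  rw [Ne, biUnion_firstPairs_eq_iff h hk.le]

/-- The translate of a set of pairs. -/
def shiftPairs (s : ℕ) (τ : Finset (Finset ℕ)) : Finset (Finset ℕ) :=
  τ.map (Finset.mapEmbedding (addRightEmbedding s)).toEmbedding

theorem mem_shiftPairs {s : ℕ} {τ : Finset (Finset ℕ)} {p : Finset ℕ} :
    p ∈ shiftPairs s τ ↔ ∃ t ∈ τ, t.map (addRightEmbedding s) = p := by
  simp [shiftPairs]

theorem shiftPairs_injective (s : ℕ) : Function.Injective (shiftPairs s) :=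
  Finset.map_injective _

/-- The concatenation of `σ`, a pair sequence of length `k`, and `τ`. -/
def joinPairs (k : ℕ) (σ τ : Finset (Finset ℕ)) : Finset (Finset ℕ) :=
  σ ∪ shiftPairs (2 * k) τ

theorem mem_Icc_of_mem_shiftPairs {e k : ℕ} {τ : Finset (Finset ℕ)} (hτ : τ ∈ pairSequences e)
    {p : Finset ℕ} (hp : p ∈ shiftPairs (2 * k) τ) {n : ℕ} (hn : n ∈ p) :
    2 * k + 1 ≤ n ∧ n ≤ 2 * (k + e) := by
  obtain ⟨t, ht, rfl⟩ := mem_shiftPairs.1 hp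
  obtain ⟨m, hm, rfl⟩ := Finset.mem_map.1 hn
  have := Finset.mem_Icc.1 (subset_Icc_of_mem hτ ht hm)
  simp only [addRightEmbedding_apply]
  omega

theorem joinPairs_mem {k e : ℕ} {σ τ : Finset (Finset ℕ)} (hσ : σ ∈ pairSequences k)
    (hτ : τ ∈ pairSequences e) : joinPairs k σ τ ∈ pairSequences (k + e) := by
  have hσ' := mem_pairSequences.1 hσ
  have hτ' := mem_pairSequences.1 hτ
  have hdis : ∀ p ∈ σ, ∀ q ∈ shiftPairs (2 * k) τ, Disjoint p q := by
    intro p hp q hq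
    rw [Finset.disjoint_left]
    intro n hn hn'
    have h1 := Finset.mem_Icc.1 (subset_Icc_of_mem hσ hp hn)
    have h2 := mem_Icc_of_mem_shiftPairs hτ hq hn'
    omega
  refine mem_pairSequences.2 ⟨?_, ?_, ?_⟩
  · intro p hp
    rcases Finset.mem_union.1 hp with hp | hp
    · exact hσ'.1 p hp
    · obtain ⟨t, ht, rfl⟩ := mem_shiftPairs.1 hp
      rw [Finset.card_map, hτ'.1 t ht]
  · intro p hp q hq hne
    rcases Finset.mem_union.1 hp with hp | hp <;> rcases Finset.mem_union.1 hq with hq | hq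
    · exact hσ'.2.1 p hp q hq hne
    · exact hdis p hp q hq
    · exact (hdis q hq p hp).symm
    · obtain ⟨t, ht, rfl⟩ := mem_shiftPairs.1 hp
      obtain ⟨u, hu, rfl⟩ := mem_shiftPairs.1 hq
      rw [Finset.disjoint_map]
      exact hτ'.2.1 t ht u hu fun h => hne (by rw [h])
  · ext n
    simp only [Finset.mem_biUnion, id]
    constructor
    · rintro ⟨p, hp, hn⟩
      rw [Finset.mem_Icc]
      rcases Finset.mem_union.1 hp with hp | hp
      · have := Finset.mem_Icc.1 (subset_Icc_of_mem hσ hp hn)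
        omega
      · have := mem_Icc_of_mem_shiftPairs hτ hp hn
        omega
    · intro hn
      rw [Finset.mem_Icc] at hn
      by_cases hnk : n ≤ 2 * k
      · obtain ⟨p, hp, hnp⟩ := exists_mem_of_mem_Icc hσ (Finset.mem_Icc.2 ⟨hn.1, hnk⟩)
        exact ⟨p, Finset.mem_union_left _ hp, hnp⟩
      · obtain ⟨t, ht, hnt⟩ := exists_mem_of_mem_Icc hτ (n := n - 2 * k)
          (Finset.mem_Icc.2 ⟨by omega, by omega⟩)
        refine ⟨_, Finset.mem_union_right _ (mem_shiftPairs.2 ⟨t, ht, rfl⟩),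
          Finset.mem_map.2 ⟨_, hnt, ?_⟩⟩
        simp only [addRightEmbedding_apply]
        omega

theorem splitsAt_joinPairs_iff {k e : ℕ} {σ τ : Finset (Finset ℕ)} (hσ : σ ∈ pairSequences k)
    (hτ : τ ∈ pairSequences e) (j : ℕ) : SplitsAt (joinPairs k σ τ) (k + j) ↔ SplitsAt τ j := by
  have hmem : ∀ t ∈ τ, ∀ n ∈ t,
      (n ∈ Finset.Icc 1 (2 * j) ↔ n + 2 * k ∈ Finset.Icc 1 (2 * (k + j))) := by
    intro t ht n hn
    have := Finset.mem_Icc.1 (subset_Icc_of_mem hτ ht hn)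
    rw [Finset.mem_Icc, Finset.mem_Icc]
    omega
  have hsub : ∀ t ∈ τ, (t ⊆ Finset.Icc 1 (2 * j) ↔
      t.map (addRightEmbedding (2 * k)) ⊆ Finset.Icc 1 (2 * (k + j))) := by
    intro t ht
    rw [Finset.map_subset_iff_subset_preimage, Finset.subset_iff, Finset.subset_iff]
    refine forall_congr' fun n => forall_congr' fun hn => ?_
    rw [hmem t ht n hn]
    simp
  have hdis : ∀ t ∈ τ, (Disjoint t (Finset.Icc 1 (2 * j)) ↔
      Disjoint (t.map (addRightEmbedding (2 * k))) (Finset.Icc 1 (2 * (k + j)))) := by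
    intro t ht
    rw [Finset.disjoint_left, Finset.disjoint_left, Finset.forall_mem_map]
    refine forall_congr' fun n => forall_congr' fun hn => ?_
    rw [hmem t ht n hn]
    simp
  constructor
  · intro h t ht
    rw [hsub t ht, hdis t ht]
    exact h _ (Finset.mem_union_right _ (mem_shiftPairs.2 ⟨t, ht, rfl⟩))
  · intro h p hp
    rcases Finset.mem_union.1 hp with hp | hp
    · exact Or.inl ((subset_Icc_of_mem hσ hp).trans (Finset.Icc_subset_Icc le_rfl (by omega)))
    · obtain ⟨t, ht, rfl⟩ := mem_shiftPairs.1 hp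
      rw [← hsub t ht, ← hdis t ht]
      exact h t ht

theorem not_subset_of_mem_shiftPairs {e k : ℕ} {τ : Finset (Finset ℕ)} (hτ : τ ∈ pairSequences e)
    {p : Finset ℕ} (hp : p ∈ shiftPairs (2 * k) τ) : ¬ p ⊆ Finset.Icc 1 (2 * k) := by
  obtain ⟨t, ht, rfl⟩ := mem_shiftPairs.1 hp
  obtain ⟨n, hn⟩ := (nonempty_of_mem hτ ht).map (f := addRightEmbedding (2 * k))
  intro hsub
  have h1 := mem_Icc_of_mem_shiftPairs hτ hp hn
  have h2 := Finset.mem_Icc.1 (hsub hn)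
  omega

theorem filter_joinPairs {k e : ℕ} {σ τ : Finset (Finset ℕ)} (hσ : σ ∈ pairSequences k)
    (hτ : τ ∈ pairSequences e) :
    (joinPairs k σ τ).filter (· ⊆ Finset.Icc 1 (2 * k)) = σ ∧
      (joinPairs k σ τ).filter (¬ · ⊆ Finset.Icc 1 (2 * k)) = shiftPairs (2 * k) τ := by
  have h1 : ∀ p ∈ σ, p ⊆ Finset.Icc 1 (2 * k) := fun p hp => subset_Icc_of_mem hσ hp
  have h2 : ∀ p ∈ shiftPairs (2 * k) τ, ¬ p ⊆ Finset.Icc 1 (2 * k) := fun p hp =>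
    not_subset_of_mem_shiftPairs hτ hp
  constructor
  · ext p
    simp only [joinPairs, Finset.mem_filter, Finset.mem_union]
    exact ⟨fun h => h.1.resolve_right fun h' => h2 p h' h.2, fun h => ⟨Or.inl h, h1 p h⟩⟩
  · ext p
    simp only [joinPairs, Finset.mem_filter, Finset.mem_union]
    exact ⟨fun h => h.1.resolve_left fun h' => h.2 (h1 p h'), fun h => ⟨Or.inr h, h2 p h⟩⟩

theorem SplitsAt.exists_joinPairs {k e : ℕ} {π : Finset (Finset ℕ)}
    (h : π ∈ pairSequences (k + e)) (hs : SplitsAt π k) :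
    ∃ σ ∈ pairSequences k, ∃ τ ∈ pairSequences e, joinPairs k σ τ = π := by
  have h' := mem_pairSequences.1 h
  set B := π.filter (¬ · ⊆ Finset.Icc 1 (2 * k)) with hB
  have hBlt : ∀ p ∈ B, ∀ n ∈ p, 2 * k + 1 ≤ n := by
    intro p hp n hn
    rw [hB, Finset.mem_filter] at hp
    have h1 := Finset.disjoint_left.1 ((hs p hp.1).resolve_left hp.2) hn
    have h2 := Finset.mem_Icc.1 (subset_Icc_of_mem h hp.1 hn)
    rw [Finset.mem_Icc] at h1
    omega
  -- All elements of pairs in `B` exceed `2k`, so each pair is the translate of its down-shift and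
  -- `B` is a shifted family `τ`.
  obtain ⟨τ, -, hτ⟩ : ∃ τ ⊆ B.image fun p => p.image (· - 2 * k), B =
      τ.map (Finset.mapEmbedding (addRightEmbedding (2 * k))).toEmbedding := by
    rw [← Finset.subset_map_iff]
    intro p hp
    refine Finset.mem_map.2 ⟨_, Finset.mem_image_of_mem _ hp, ?_⟩
    ext n
    simp only [RelEmbedding.coe_toEmbedding, Finset.mapEmbedding_apply, Finset.mem_map,
      Finset.mem_image, addRightEmbedding_apply]
    constructor
    · rintro ⟨_, ⟨m, hm, rfl⟩, rfl⟩
      have := hBlt p hp m hm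
      rwa [Nat.sub_add_cancel (by omega)]
    · intro hn
      have := hBlt p hp n hn
      exact ⟨_, ⟨n, hn, rfl⟩, by omega⟩
  have hτB : ∀ t ∈ τ, t.map (addRightEmbedding (2 * k)) ∈ B := fun t ht => by
    rw [hτ]; exact mem_shiftPairs.2 ⟨t, ht, rfl⟩
  have hBπ : ∀ p ∈ B, p ∈ π := fun p hp => (Finset.mem_filter.1 hp).1
  refine ⟨_, hs.lower_mem h (by omega), τ, mem_pairSequences.2 ⟨fun t ht => ?_,
    fun t ht u hu hne => ?_, ?_⟩, ?_⟩
  · rw [← h'.1 _ (hBπ _ (hτB t ht)), Finset.card_map]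
  · rw [← Finset.disjoint_map (addRightEmbedding (2 * k))]
    exact h'.2.1 _ (hBπ _ (hτB t ht)) _ (hBπ _ (hτB u hu)) fun he =>
      hne (Finset.map_injective _ he)
  · ext n
    simp only [Finset.mem_biUnion, id]
    constructor
    · rintro ⟨t, ht, hn⟩
      have hn' : n + 2 * k ∈ t.map (addRightEmbedding (2 * k)) := by simpa using hn
      have h1 := hBlt _ (hτB t ht) _ hn'
      have h2 := Finset.mem_Icc.1 (subset_Icc_of_mem h (hBπ _ (hτB t ht)) hn')
      rw [Finset.mem_Icc]
      omega
    · intro hn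
      rw [Finset.mem_Icc] at hn
      obtain ⟨p, hp, hnp⟩ := exists_mem_of_mem_Icc h (n := n + 2 * k)
        (Finset.mem_Icc.2 ⟨by omega, by omega⟩)
      have hpB : p ∈ B := by
        rw [hB, Finset.mem_filter]
        refine ⟨hp, fun hsub => ?_⟩
        have := Finset.mem_Icc.1 (hsub hnp)
        omega
      rw [hτ] at hpB
      obtain ⟨t, ht, rfl⟩ := mem_shiftPairs.1 hpB
      exact ⟨t, ht, by simpa using hnp⟩
  · have : shiftPairs (2 * k) τ = B := hτ.symm
    rw [joinPairs, this, hB, Finset.filter_union_filter_not_eq]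

/-- Cut at the last split `k < d`, where `k = 0` always qualifies: what follows it has no interior
split, that is, it is good, and what precedes it is arbitrary. -/
theorem card_pairSequences_eq_sum {d : ℕ} (hd : 1 ≤ d) :
    (pairSequences d).card =
      ∑ k ∈ Finset.range d, (pairSequences k).card * numGood (d - k) := by
  classical
  have hgood : ∀ {e τ}, τ ∈ goodPairSequences e ↔
      τ ∈ pairSequences e ∧ ∀ k < e, 0 < k → ¬ SplitsAt τ k := by
    intro e τ
    rw [goodPairSequences, Finset.mem_filter]
    exact and_congr_right fun h => isGoodPairSequence_iff h
  have hunion : pairSequences d = (Finset.range d).biUnion fun k =>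
      (pairSequences k ×ˢ goodPairSequences (d - k)).image fun x => joinPairs k x.1 x.2 := by
    ext π
    simp only [Finset.mem_biUnion, Finset.mem_range, Finset.mem_image, Finset.mem_product,
      Prod.exists]
    constructor
    · intro hπ
      obtain ⟨k, hkd, hsk, hmax⟩ : ∃ k ≤ d - 1, SplitsAt π k ∧
          ∀ j ≤ d - 1, SplitsAt π j → j ≤ k :=
        ⟨Nat.findGreatest (SplitsAt π) (d - 1), Nat.findGreatest_le _,
          Nat.findGreatest_spec (Nat.zero_le _) (splitsAt_zero π),
          fun j hj => Nat.le_findGreatest hj⟩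
      obtain ⟨e, rfl⟩ : ∃ e, d = k + e := ⟨d - k, by omega⟩
      obtain ⟨σ, hσ, τ, hτ, hj⟩ := hsk.exists_joinPairs hπ
      refine ⟨k, by omega, σ, τ, ⟨hσ, ?_⟩, hj⟩
      rw [Nat.add_sub_cancel_left, hgood]
      refine ⟨hτ, fun j hj1 hj0 hsj => ?_⟩
      rw [← splitsAt_joinPairs_iff hσ hτ, hj] at hsj
      have := hmax _ (by omega) hsj
      omega
    · rintro ⟨k, hk, σ, τ, ⟨hσ, hτ⟩, rfl⟩
      have := joinPairs_mem hσ (hgood.1 hτ).1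
      rwa [Nat.add_sub_cancel' hk.le] at this
  -- If a sequence arose from both `k < k'`, the good part after `k` would split at `k' - k`.
  have key : ∀ k k', k < k' → k' < d → ∀ σ ∈ pairSequences k, ∀ τ ∈ goodPairSequences (d - k),
      ∀ σ' ∈ pairSequences k', ∀ τ' ∈ goodPairSequences (d - k'),
      joinPairs k σ τ ≠ joinPairs k' σ' τ' := by
    intro k k' hkk' hk' σ hσ τ hτ σ' hσ' τ' hτ' heq
    have h1 : SplitsAt (joinPairs k' σ' τ') (k' + 0) :=
      (splitsAt_joinPairs_iff hσ' (hgood.1 hτ').1 0).2 (splitsAt_zero _)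
    have h2 : k' + 0 = k + (k' - k) := by omega
    rw [← heq, h2, splitsAt_joinPairs_iff hσ (hgood.1 hτ).1] at h1
    exact (hgood.1 hτ).2 _ (by omega) (by omega) h1
  conv_lhs => rw [hunion]
  rw [Finset.card_biUnion]
  · refine Finset.sum_congr rfl fun k _ => ?_
    rw [Finset.card_image_of_injOn, Finset.card_product, numGood]
    rintro ⟨σ, τ⟩ h ⟨σ', τ'⟩ h' heq
    simp only [Finset.coe_product, Set.mem_prod, Finset.mem_coe] at h h' heq
    have e1 := filter_joinPairs h.1 (hgood.1 h.2).1
    have e2 := filter_joinPairs h'.1 (hgood.1 h'.2).1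
    rw [heq] at e1
    exact Prod.ext (e1.1.symm.trans e2.1) (shiftPairs_injective _ (e1.2.symm.trans e2.2))
  · intro k hk k' hk' hne
    rw [Function.onFun, Finset.disjoint_left]
    rintro π hπ hπ'
    simp only [Finset.mem_image, Finset.mem_product, Prod.exists, Finset.mem_coe,
      Finset.mem_range] at hπ hπ' hk hk'
    obtain ⟨σ, τ, ⟨hσ, hτ⟩, rfl⟩ := hπ
    obtain ⟨σ', τ', ⟨hσ', hτ'⟩, heq⟩ := hπ'
    rcases lt_or_gt_of_ne hne with hlt | hlt
    · exact key k k' hlt hk' σ hσ τ hτ σ' hσ' τ' hτ' heq.symm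
    · exact key k' k hlt hk σ' hσ' τ' hτ' σ hσ τ hτ heq

theorem numGood_recursion {d : ℕ} (hd : 1 ≤ d) :
    (numGood d : ℤ) = ((2 * d - 1)‼ : ℕ) -
      ∑ k ∈ Finset.Icc 1 (d - 1), (((2 * k - 1)‼ : ℕ) : ℤ) * (numGood (d - k) : ℤ) := by
  have h := card_pairSequences_eq_sum hd
  simp only [card_pairSequences] at h
  -- The term `k = 0` is `numGood d`, since truncated subtraction gives `0‼ = 1`.
  rw [Finset.range_eq_Ico, Finset.sum_eq_sum_Ico_succ_bot hd] at h
  have h2 : Finset.Ico (0 + 1) d = Finset.Icc 1 (d - 1) := by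
    ext n; simp only [Finset.mem_Ico, Finset.mem_Icc]; omega
  rw [h2] at h
  rw [h]
  push_cast
  simp

/-! ### LP-orientations are those with a good pair sequence. -/

theorem IsLPOrientation.isAcyclic {V : Type} {d : ℕ} {p : V → Fin d → ℝ}
    {O : GraphOrientation (polyGraph p)} (h : IsLPOrientation p O) : O.IsAcyclic := by
  obtain ⟨q, -, f, hf⟩ := h
  have hstep : ∀ v w, O.arc v w → f (q v) < f (q w) := fun v w hvw =>
    (hf v w ((O.arc_or_arc_iff v w).1 (Or.inl hvw))).1 hvw
  have key : ∀ v w, Relation.TransGen O.arc v w → f (q v) < f (q w) := by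
    intro v w hvw
    induction hvw with
    | single hvw => exact hstep _ _ hvw
    | tail _ hvw ih => exact ih.trans (hstep _ _ hvw)
  exact fun v hv => lt_irrefl _ (key v v hv)

namespace CrossOrientation

variable {d : ℕ} {O : CrossOrientation d} {lab : CrossLabeling d}

theorem IsLabeledBy.pairs_mem_good_of_isLP (h : O.IsLabeledBy lab)
    (hLP : IsLPOrientation (crosspolytope d) O) : lab.pairs ∈ goodPairSequences d := by
  rw [goodPairSequences, Finset.mem_filter, isGoodPairSequence_iff lab.pairs_mem_pairSequences]
  refine ⟨lab.pairs_mem_pairSequences, fun k hk hk0 hs => ?_⟩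
  have hd : 2 ≤ d := by omega
  obtain ⟨q, hq, f, hf⟩ := hLP
  let I : Set (Fin d) := {i | ∀ b, (lab (i, b) : ℕ) ≤ 2 * k}
  have hI : ∀ v : CrossVertex d, v.1 ∈ I ↔ (lab v : ℕ) ≤ 2 * k := by
    intro v
    refine ⟨fun hv => hv v.2, fun hv => ?_⟩
    have hmem : lab.pairOf v.1 ∈ lab.pairs := by
      rw [lab.pairs_eq]; exact Finset.mem_image_of_mem _ (Finset.mem_univ _)
    rcases hs _ hmem with hsub | hdis
    · intro b
      exact (Finset.mem_Icc.1 (hsub ((lab.val_mem_pairOf (v := (v.1, b))).2 rfl))).2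
    · exact absurd (Finset.mem_Icc.2 ⟨lab.one_le v, hv⟩)
        (Finset.disjoint_left.1 hdis (lab.val_mem_pairOf.2 rfl))
  obtain ⟨v₁, hv₁⟩ := lab.exists_eq (n := 1) le_rfl (by omega)
  obtain ⟨v₂, hv₂⟩ := lab.exists_eq (n := 2 * d) (by omega) le_rfl
  have hv₁I : v₁.1 ∈ I := (hI v₁).2 (by omega)
  have hv₂I : v₂.1 ∉ I := fun hc => by have := (hI v₂).1 hc; omega
  -- Every vertex outside `I` is adjacent to `u` and has a larger label, so the level of `f` through
  -- `u` separates the pairs in `I` from the others.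
  obtain ⟨u, hu, hmax⟩ := Set.exists_max_image {v : CrossVertex d | v.1 ∈ I}
    (fun v => f (q v)) (Set.toFinite _) ⟨v₁, hv₁I⟩
  refine not_separated (q := q) (by rw [hq.faces_eq, polyFaces_crosspolytope]) ⟨_, hv₁I⟩
    ⟨_, hv₂I⟩ (g := fun v => f (q v) - f (q u)) ⟨f, -f (q u), fun v => sub_eq_add_neg _ _⟩
    (fun v hv => by linarith [hmax v hv]) fun v hv => ?_
  have hadj : (polyGraph (crosspolytope d)).Adj u v :=
    (crosspolytope_adj hd u v).2 fun he => hv (by rw [← he]; exact hu)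
  have h1 := (hI u).1 hu
  have h2 : ¬ (lab v : ℕ) ≤ 2 * k := fun hc => hv ((hI v).2 hc)
  have := (hf u v hadj).1 (h.arc_iff.2 ⟨hadj, by omega⟩)
  linarith

theorem IsLabeledBy.isLP_of_pairs_mem_good (h : O.IsLabeledBy lab)
    (hgood : lab.pairs ∈ goodPairSequences d) : IsLPOrientation (crosspolytope d) O := by
  classical
  rw [goodPairSequences, Finset.mem_filter,
    isGoodPairSequence_iff lab.pairs_mem_pairSequences] at hgood
  replace hgood := hgood.2
  let m : Fin d → ℕ := fun i => min (lab (i, true) : ℕ) (lab (i, false))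
  have hmb : ∀ i, ∃ b, (lab (i, b) : ℕ) = m i ∧ m i + 1 ≤ lab (i, !b) := by
    intro i
    have := lab.ne i
    rcases lt_or_gt_of_ne this with hlt | hlt
    · exact ⟨true, by simp only [m]; omega, by simp only [m, Bool.not_true]; omega⟩
    · exact ⟨false, by simp only [m]; omega, by simp only [m, Bool.not_false]; omega⟩
  have hmle : ∀ v : CrossVertex d, m v.1 ≤ lab v := by
    rintro ⟨i, b⟩
    cases b <;> simp only [m] <;> omega
  have hm : Function.Injective m := by
    intro i j hij
    obtain ⟨b, hb, -⟩ := hmb i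
    obtain ⟨c, hc, -⟩ := hmb j
    exact congrArg Prod.fst (lab.val_inj.1 (hb.trans (hij.trans hc.symm)))
  -- This is where goodness enters: otherwise the earlier pairs would fill exactly the labels below
  -- `m i`, and the sequence would split there.
  have hbig : ∀ i, (∃ j, m j < m i) →
      ∃ w : CrossVertex d, m w.1 < m i ∧ m i < (lab w : ℕ) := by
    rintro i ⟨j₀, hj₀⟩
    by_contra! hcon
    have hlt : ∀ v : CrossVertex d, m v.1 < m i ↔ (lab v : ℕ) < m i := by
      intro v
      refine ⟨fun hv => lt_of_le_of_ne (hcon v hv) fun he => ?_, (hmle v).trans_lt⟩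
      obtain ⟨b, hb, -⟩ := hmb i
      rw [← hb, lab.val_inj] at he
      rw [he] at hv
      exact lt_irrefl _ hv
    set K := Finset.univ.filter fun j => m j < m i with hK
    have hcard : m i = 2 * K.card + 1 := by
      have h1 : (Finset.univ.filter fun v : CrossVertex d => m v.1 < m i) =
          K ×ˢ Finset.univ := by
        ext v; simp [hK]
      have h2 : (Finset.univ.filter fun v : CrossVertex d => m v.1 < m i).image
          (fun v => (lab v : ℕ)) = Finset.Ico 1 (m i) := by
        ext n
        simp only [Finset.mem_image, Finset.mem_filter, Finset.mem_univ, true_and,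
          Finset.mem_Ico, hlt]
        constructor
        · rintro ⟨v, hv, rfl⟩
          exact ⟨lab.one_le v, hv⟩
        · rintro ⟨hn1, hn2⟩
          obtain ⟨b, hb, -⟩ := hmb i
          have := lab.le (i, b)
          obtain ⟨v, rfl⟩ := lab.exists_eq hn1 (by omega)
          exact ⟨v, hn2, rfl⟩
      have h3 := congrArg Finset.card h2
      rw [Finset.card_image_of_injective _ fun a b hab => lab.val_inj.1 hab, h1,
        Finset.card_product, Finset.card_univ, Fintype.card_bool, Nat.card_Ico] at h3
      obtain ⟨b, hb, -⟩ := hmb i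
      have := lab.one_le (i, b)
      omega
    refine hgood K.card ?_ (Finset.card_pos.2 ⟨j₀, by simpa [hK] using hj₀⟩) fun p hp => ?_
    · have : K ⊂ Finset.univ := Finset.ssubset_univ_iff.2 fun he => by
        have : i ∈ K := he ▸ Finset.mem_univ i
        simp [hK] at this
      simpa using Finset.card_lt_card this
    · rw [lab.pairs_eq, Finset.mem_image] at hp
      obtain ⟨j, -, rfl⟩ := hp
      by_cases hj : m j < m i
      · left
        intro n hn
        obtain ⟨b, rfl⟩ := lab.mem_pairOf.1 hn
        have h1 := (hlt (j, b)).1 hj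
        have h2 := lab.one_le (j, b)
        rw [Finset.mem_Icc]
        omega
      · right
        rw [Finset.disjoint_left]
        intro n hn hn'
        obtain ⟨b, rfl⟩ := lab.mem_pairOf.1 hn
        have h1 := hmle (j, b)
        rw [Finset.mem_Icc] at hn'
        simp only at h1
        omega
  -- The level `c i` is half a unit above the value at the smaller label of pair `i` and at least
  -- half a unit below the value at the larger one. The shift by `3 / 2` makes `c i = 0` for the
  -- first pair, whose weighted sum is empty.
  let ψ : CrossVertex d → ℝ := fun v => (lab v : ℕ) - 3 / 2
  let c : Fin d → ℝ := fun i => m i - 1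
  have hW : ∀ i, ∃ W : CrossVertex d → ℝ, (∀ v : CrossVertex d, m v.1 < m i → 0 < W v) ∧
      (∀ v : CrossVertex d, ¬ m v.1 < m i → W v = 0) ∧
      ((∃ j, m j < m i) → ∑ v, W v = 1) ∧ ∑ v, W v * ψ v = c i := by
    intro i
    by_cases hpred : ∃ j, m j < m i
    · obtain ⟨w, hw1, hw2⟩ := hbig i hpred
      obtain ⟨j, hj⟩ := hpred
      obtain ⟨b, hb, -⟩ := hmb j
      obtain ⟨W, hpos, hone, hmean⟩ := exists_weights
        (Finset.univ.filter fun v : CrossVertex d => m v.1 < m i) ψ (c i) (u := (j, b)) (w := w)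
        (by simpa using hj) (by simpa using hw1)
        (by
          have : (m j : ℝ) + 1 ≤ m i := by exact_mod_cast hj
          simp only [ψ, c, hb]; linarith)
        (by
          have : (m i : ℝ) + 1 ≤ (lab w : ℕ) := by exact_mod_cast hw2
          simp only [ψ, c]; linarith)
      refine ⟨fun v => if m v.1 < m i then W v else 0, fun v hv => ?_, fun v hv => if_neg hv,
        fun _ => ?_, ?_⟩
      · dsimp only
        rw [if_pos hv]
        exact hpos v (by simpa using hv)
      · rw [← Finset.sum_filter, hone]
      · simp only [ite_mul, zero_mul]
        rw [← Finset.sum_filter, hmean]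
    · refine ⟨0, fun v hv => absurd ⟨_, hv⟩ hpred, fun _ _ => rfl, fun hc => absurd hc hpred, ?_⟩
      obtain ⟨b, hb, -⟩ := hmb i
      have h1 := lab.one_le (i, b)
      have h2 := lab.le (i, b)
      obtain ⟨v, hv⟩ := lab.exists_eq (n := 1) le_rfl (by omega)
      have h3 := hmle v
      have h4 : ¬ m v.1 < m i := fun hc => hpred ⟨_, hc⟩
      have h5 : m i = 1 := by omega
      simp [c, h5]
  choose W hpos hzero hone hmean using hW
  obtain ⟨q, hq, hsum⟩ := exists_isCrossLike m hm ψ c W hpos hzero hone hmean (by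
    intro i b
    obtain ⟨b', hb', hb2⟩ := hmb i
    have h1 : ψ (i, b') - c i = -(1 / 2) := by simp only [ψ, c, hb']; ring
    have h2 : 0 < ψ (i, !b') - c i := by
      have : (m i : ℝ) + 1 ≤ (lab (i, !b') : ℕ) := by exact_mod_cast hb2
      simp only [ψ, c]; linarith
    by_cases hbb : b = b'
    · rw [hbb, h1]; linarith
    · rw [Bool.eq_not_of_ne hbb, Bool.not_not, h1]; linarith)
  refine ⟨q, hq.isRealization, ∑ k, LinearMap.proj k, fun v w hadj => ?_⟩
  rw [h.arc_iff, and_iff_right hadj]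
  simp only [LinearMap.sum_apply, LinearMap.proj_apply, hsum, ψ]
  rw [sub_lt_sub_iff_right, Nat.cast_lt]

/-! ### Counting orientations. -/

theorem finite : Finite (CrossOrientation d) :=
  Finite.of_injective (fun O : CrossOrientation d => O.arc) fun _ _ h => GraphOrientation.ext h

theorem HasPairSequence.mem_pairSequences {π : Finset (Finset ℕ)} (h : O.HasPairSequence π) :
    π ∈ pairSequences d := by
  obtain ⟨lab, -, rfl⟩ := h
  exact lab.pairs_mem_pairSequences

theorem pairSequences_one : pairSequences 1 = {{{1, 2}}} := by
  decide

theorem HasPairSequence.unique (hd : 1 ≤ d) {π π' : Finset (Finset ℕ)}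
    (h : O.HasPairSequence π) (h' : O.HasPairSequence π') : π = π' := by
  -- For `d = 1` antipodes are adjacent and `label_eq` is unavailable, but there is only one pair
  -- sequence.
  rcases hd.eq_or_lt with rfl | hd
  · have h1 := h.mem_pairSequences
    have h2 := h'.mem_pairSequences
    rw [pairSequences_one, Finset.mem_singleton] at h1 h2
    rw [h1, h2]
  · obtain ⟨lab, hl, rfl⟩ := h
    obtain ⟨lab', hl', rfl⟩ := h'
    exact hl.pairs_eq hd hl'

theorem isLP_iff (hO : O.IsAcyclic) :
    IsLPOrientation (crosspolytope d) O ↔ ∃ π ∈ goodPairSequences d, O.HasPairSequence π := by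
  constructor
  · intro hLP
    obtain ⟨lab, hlab⟩ := exists_isLabeledBy hO
    exact ⟨_, hlab.pairs_mem_good_of_isLP hLP, lab, hlab, rfl⟩
  · rintro ⟨_, hπ, lab, hlab, rfl⟩
    exact hlab.isLP_of_pairs_mem_good hπ

theorem card_labeled_acyclic {π : Finset (Finset ℕ)} (hπ : π ∈ pairSequences d) :
    Nat.card {x : CrossOrientation d × CrossLabeling d //
      x.1.IsAcyclic ∧ x.1.IsLabeledBy x.2 ∧ x.2.pairs = π} = 2 ^ d * d ! := by
  obtain ⟨lab, rfl, -⟩ := exists_labeling hπ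
  rw [← lab.card_pairs_eq]
  refine Nat.card_eq_of_bijective (fun x => ⟨x.1.2, x.2.2.2⟩) ⟨?_, ?_⟩
  · rintro ⟨⟨O, l⟩, _, h, _⟩ ⟨⟨O', l'⟩, _, h', _⟩ heq
    have heq' : l = l' := congrArg Subtype.val heq
    subst heq'
    have : O = O' := h.eq_orientation.trans h'.eq_orientation.symm
    subst this
    rfl
  · rintro ⟨l, hl⟩
    exact ⟨⟨(l.orientation, l), l.orientation_isLabeledBy.isAcyclic, l.orientation_isLabeledBy,
      hl⟩, rfl⟩

/-- For `d ≥ 2` each orientation has exactly one canonical labeling. For `d = 1` the whole polytope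
is an edge, and the orientation determines the labeling outright. -/
theorem card_acyclic {π : Finset (Finset ℕ)} (hd : 1 ≤ d) (hπ : π ∈ pairSequences d) :
    Nat.card {O : CrossOrientation d // O.IsAcyclic ∧ O.HasPairSequence π} =
      orientationMultiplicity d π := by
  obtain ⟨lab, rfl, hlt⟩ := exists_labeling hπ
  rcases hd.eq_or_lt with rfl | hd
  · rw [orientationMultiplicity, if_pos rfl]
    have h2 : (2 : ℕ) = 2 ^ 1 * 1 ! := rfl
    conv_rhs => rw [h2, ← lab.card_pairs_eq]
    refine (Nat.card_eq_of_bijective (fun l => ⟨l.1.orientation,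
      l.1.orientation_isLabeledBy.isAcyclic, l.1, l.1.orientation_isLabeledBy, l.2⟩)
      ⟨?_, ?_⟩).symm
    · rintro ⟨l, hl⟩ ⟨l', hl'⟩ heq
      have heq' : l.orientation = l'.orientation := congrArg Subtype.val heq
      have hadj : (polyGraph (crosspolytope 1)).Adj (0, true) (0, false) := by
        refine ⟨by simp, ?_⟩
        rw [polyFaces_crosspolytope]
        left
        ext ⟨i, b⟩
        have : i = 0 := Subsingleton.elim _ _
        subst this
        cases b <;> simp
      have h1 : (l (0, true) : ℕ) < l (0, false) ↔ (l' (0, true) : ℕ) < l' (0, false) := by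
        have h3 := l.orientation_isLabeledBy.arc_iff (v := (0, true)) (w := (0, false))
        have h4 := l'.orientation_isLabeledBy.arc_iff (v := (0, true)) (w := (0, false))
        rw [and_iff_right hadj] at h3 h4
        rw [← h3, ← h4, heq']
      have b1 := l.one_le (0, true)
      have b2 := l.one_le (0, false)
      have b3 := l.le (0, true)
      have b4 := l.le (0, false)
      have b5 := l.ne 0
      have c1 := l'.one_le (0, true)
      have c2 := l'.one_le (0, false)
      have c3 := l'.le (0, true)
      have c4 := l'.le (0, false)
      have c5 := l'.ne 0
      refine Subtype.ext (Equiv.ext fun ⟨i, b⟩ => Subtype.ext ?_)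
      have : i = 0 := Subsingleton.elim _ _
      subst this
      cases b <;> simp only <;> omega
    · rintro ⟨O, hO, l, hl, hlp⟩
      exact ⟨⟨l, hlp⟩, Subtype.ext hl.eq_orientation.symm⟩
  · rw [orientationMultiplicity, if_neg (by omega), ← lab.card_canonical hlt]
    refine (Nat.card_eq_of_bijective (fun l => ⟨l.1.orientation,
      l.1.orientation_isLabeledBy.isAcyclic, l.1, l.1.orientation_isLabeledBy, l.2.1⟩)
      ⟨?_, ?_⟩).symm
    · rintro ⟨l, hl, hc⟩ ⟨l', hl', hc'⟩ heq
      have heq' : l.orientation = l'.orientation := congrArg Subtype.val heq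
      refine Subtype.ext (l.orientation_isLabeledBy.eq_of_isCanonical hd ?_ hc hc')
      rw [heq']
      exact l'.orientation_isLabeledBy
    · rintro ⟨O, hO, l, hl, hlp⟩
      obtain ⟨l', hl', hp, hc⟩ := hl.exists_isCanonical hd
      exact ⟨⟨l', hp.trans hlp, hc⟩, Subtype.ext hl'.eq_orientation.symm⟩

theorem card_labeled_isLP :
    Nat.card {x : CrossOrientation d × CrossLabeling d //
      IsLPOrientation (crosspolytope d) x.1 ∧ x.1.IsLabeledBy x.2} =
      2 ^ d * d ! * numGood d := by
  have h1 : Nat.card {x : CrossOrientation d × CrossLabeling d //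
      IsLPOrientation (crosspolytope d) x.1 ∧ x.1.IsLabeledBy x.2} =
      Nat.card {lab : CrossLabeling d // lab.pairs ∈ goodPairSequences d} := by
    refine Nat.card_eq_of_bijective
      (fun x => ⟨x.1.2, x.2.2.pairs_mem_good_of_isLP x.2.1⟩) ⟨?_, ?_⟩
    · rintro ⟨⟨O, l⟩, _, h⟩ ⟨⟨O', l'⟩, _, h'⟩ heq
      have heq' : l = l' := congrArg Subtype.val heq
      subst heq'
      have : O = O' := h.eq_orientation.trans h'.eq_orientation.symm
      subst this
      rfl
    · rintro ⟨l, hl⟩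
      exact ⟨⟨(l.orientation, l), l.orientation_isLabeledBy.isLP_of_pairs_mem_good hl,
        l.orientation_isLabeledBy⟩, rfl⟩
  rw [h1, Nat.card_eq_fintype_card, Fintype.card_subtype,
    Finset.card_eq_sum_card_fiberwise (f := CrossLabeling.pairs) (t := goodPairSequences d)
      fun lab h => by simpa using h,
    Finset.sum_const_nat (m := 2 ^ d * d !), numGood, mul_comm]
  intro π hπ
  rw [← card_labelings_filter (Finset.mem_filter.1 hπ).1, Finset.filter_filter]
  congr 1
  refine Finset.filter_congr fun lab _ => ?_
  exact ⟨fun h => h.2, fun h => ⟨h ▸ hπ, h⟩⟩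

theorem card_isLP (hd : 1 ≤ d) :
    Nat.card {O : CrossOrientation d // IsLPOrientation (crosspolytope d) O} =
      ∑ π ∈ goodPairSequences d, orientationMultiplicity d π := by
  have := finite (d := d)
  have h1 : Nat.card {O : CrossOrientation d // IsLPOrientation (crosspolytope d) O} =
      Nat.card (Σ π : goodPairSequences d,
        {O : CrossOrientation d // O.IsAcyclic ∧ O.HasPairSequence π}) := by
    refine (Nat.card_eq_of_bijective
      (fun x => ⟨x.2.1, (isLP_iff x.2.2.1).2 ⟨_, x.1.2, x.2.2.2⟩⟩) ⟨?_, ?_⟩).symm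
    · rintro ⟨⟨π, hπ⟩, O, hO, h⟩ ⟨⟨π', hπ'⟩, O', hO', h'⟩ heq
      have heq' : O = O' := congrArg Subtype.val heq
      subst heq'
      have : π = π' := h.unique hd h'
      subst this
      rfl
    · rintro ⟨O, hLP⟩
      obtain ⟨π, hπ, h⟩ := (isLP_iff hLP.isAcyclic).1 hLP
      exact ⟨⟨⟨π, hπ⟩, O, hLP.isAcyclic, h⟩, rfl⟩
  rw [h1, Nat.card_sigma, ← Finset.sum_coe_sort (goodPairSequences d) (orientationMultiplicity d)]
  exact Finset.sum_congr rfl fun π _ => card_acyclic hd (Finset.mem_filter.1 π.2).1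

end CrossOrientation

/-! ### The Holt-Klee condition and the example in dimension 4. -/

/-- Each element of `T` other than `s` is the midpoint of a path of length two; `s` itself, if in
`T`, stands for the single arc from `s` to `t`. -/
theorem GraphOrientation.hasDisjointPathsOn_of_le_ncard {V : Type} [Finite V] {G : SimpleGraph V}
    (O : GraphOrientation G) {S T : Set V} {s t : V} (hs : s ∈ S) (ht : t ∈ S) (hst : s ≠ t)
    (hT : ∀ x ∈ T, x ∈ S ∧ x ≠ t ∧ (x = s → O.arc s t) ∧ (x ≠ s → O.arc s x ∧ O.arc x t))
    {k : ℕ} (hk : k ≤ T.ncard) : O.HasDisjointPathsOn S s t k := by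
  classical
  have := Fintype.ofFinite V
  obtain ⟨x⟩ : Nonempty (Fin k ↪ T) := by
    refine Function.Embedding.nonempty_of_card_le ?_
    rwa [Fintype.card_fin, ← Nat.card_eq_fintype_card, Nat.card_coe_set_eq]
  let P : Fin k → List V := fun i => if (x i : V) = s then [s, t] else [s, x i, t]
  have hmem : ∀ i v, v ∈ P i → v = s ∨ v = t ∨ v = x i := by
    intro i v hv
    simp only [P] at hv
    split_ifs at hv <;> simp at hv <;> tauto
  refine ⟨P, fun i j hij => ?_, fun i => ?_, fun i j hij v hi hj => ?_⟩
  · refine x.injective (Subtype.ext ?_)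
    simp only [P] at hij
    split_ifs at hij with h1 h2 h2
    · rw [h1, h2]
    · simp at hij
    · simp at hij
    · simpa using hij
  · obtain ⟨h1, h2, h3, h4⟩ := hT _ (x i).2
    by_cases hx : (x i : V) = s
    · have hP : P i = [s, t] := if_pos hx
      rw [hP]
      exact ⟨rfl, rfl, by simpa using h3 hx, by simpa using hst, by simp [hs, ht]⟩
    · have hP : P i = [s, (x i : V), t] := if_neg hx
      rw [hP]
      exact ⟨rfl, rfl, by simpa using h4 hx, by simp [hst, h2, Ne.symm hx], by simp [hs, ht, h1]⟩
  · rcases hmem i v hi with h | h | h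
    · exact Or.inl h
    · exact Or.inr h
    · rcases hmem j v hj with h' | h' | h'
      · exact Or.inl h'
      · exact Or.inr h'
      · exact absurd (x.injective (Subtype.ext (h.symm.trans h'))) hij

theorem faceDim_add_one_le_ncard {V : Type} [Finite V] {d : ℕ} (p : V → Fin d → ℝ) {S : Set V}
    (hS : S.Nonempty) : faceDim p S + 1 ≤ S.ncard := by
  classical
  have := Fintype.ofFinite V
  obtain ⟨n, hn⟩ : ∃ n, S.ncard = n + 1 :=
    Nat.exists_eq_succ_of_ne_zero ((Set.ncard_pos (Set.toFinite S)).2 hS).ne'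
  have h := finrank_vectorSpan_image_finset_le ℝ p S.toFinset
    (by rw [← Set.ncard_eq_toFinset_card', hn])
  rw [Finset.coe_image, Set.coe_toFinset] at h
  rw [faceDim, hn]
  omega

namespace CrossOrientation

variable {d : ℕ} {O : CrossOrientation d} {lab : CrossLabeling d}

theorem IsLabeledBy.arc_of_notMem_pairs (hd : 2 ≤ d) (h : O.IsLabeledBy lab)
    {v w : CrossVertex d} (hlt : (lab v : ℕ) < lab w)
    (hnot : ({(lab v : ℕ), (lab w : ℕ)} : Finset ℕ) ∉ lab.pairs) : O.arc v w := by
  refine h.arc_iff.2 ⟨(crosspolytope_adj hd v w).2 fun he => hnot ?_, hlt⟩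
  obtain ⟨i, b⟩ := v
  obtain ⟨j, c⟩ := w
  simp only at he
  subst he
  have : lab.pairOf i ∈ lab.pairs := by
    rw [lab.pairs_eq]; exact Finset.mem_image_of_mem _ (Finset.mem_univ _)
  convert this using 1
  unfold CrossLabeling.pairOf
  cases b <;> cases c
  · exact absurd hlt (lt_irrefl _)
  · exact Finset.pair_comm _ _
  · rfl
  · exact absurd hlt (lt_irrefl _)

theorem IsLabeledBy.exists_isSourceOn (h : O.IsLabeledBy lab) {S : Set (CrossVertex d)}
    (hS : S.Nonempty) : ∃ v, O.IsSourceOn S v := by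
  obtain ⟨v, hv, hmin⟩ := Set.exists_min_image S (fun v => (lab v : ℕ)) (Set.toFinite _) hS
  exact ⟨v, hv, fun w hw hwv => absurd (h w v hwv) (not_lt.2 (hmin w hw))⟩

theorem IsLabeledBy.exists_isSinkOn (h : O.IsLabeledBy lab) {S : Set (CrossVertex d)}
    (hS : S.Nonempty) : ∃ v, O.IsSinkOn S v := by
  obtain ⟨v, hv, hmax⟩ := Set.exists_max_image S (fun v => (lab v : ℕ)) (Set.toFinite _) hS
  exact ⟨v, hv, fun w hw hvw => absurd (h v w hvw) (not_lt.2 (hmax w hw))⟩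

theorem arc_or_arc_of_isAntipodeFree (hd : 2 ≤ d) {S : Set (CrossVertex d)}
    (hS : IsAntipodeFree S) {v w : CrossVertex d} (hv : v ∈ S) (hw : w ∈ S) (hne : v ≠ w) :
    O.arc v w ∨ O.arc w v := by
  refine (O.arc_or_arc_iff v w).2 ((crosspolytope_adj hd v w).2 fun he => ?_)
  obtain ⟨i, b⟩ := v
  obtain ⟨j, c⟩ := w
  simp only at he
  subst he
  have : c = !b := Bool.eq_not_of_ne fun hc => hne (by rw [hc])
  subst this
  exact hS i b hv hw

/-- The faces without antipodal pairs are simplices, and an acyclic orientation satisfies the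
Holt-Klee condition on them. -/
theorem hasDisjointPathsOn_of_isAntipodeFree (hd : 2 ≤ d) {S : Set (CrossVertex d)}
    (hS : IsAntipodeFree S) {s t : CrossVertex d} (hs : O.IsSourceOn S s) (ht : O.IsSinkOn S t) :
    O.HasDisjointPathsOn S s t (faceDim (crosspolytope d) S) := by
  have hdim := faceDim_add_one_le_ncard (crosspolytope d) ⟨s, hs.1⟩
  have harc₁ : ∀ x ∈ S, x ≠ s → O.arc s x := fun x hx hne =>
    (arc_or_arc_of_isAntipodeFree hd hS hs.1 hx hne.symm).resolve_right (hs.2 x hx)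
  have harc₂ : ∀ x ∈ S, x ≠ t → O.arc x t := fun x hx hne =>
    (arc_or_arc_of_isAntipodeFree hd hS hx ht.1 hne).resolve_right (ht.2 x hx)
  by_cases hst : s = t
  · subst hst
    have : S = {s} := by
      refine Set.eq_singleton_iff_unique_mem.2 ⟨hs.1, fun x hx => ?_⟩
      by_contra hne
      exact ht.2 x hx (harc₁ x hx hne)
    rw [this, Set.ncard_singleton] at hdim
    have h0 : faceDim (crosspolytope d) S = 0 := by rw [this]; omega
    rw [h0]
    exact ⟨fun i => i.elim0, fun i => i.elim0, fun i => i.elim0, fun i => i.elim0⟩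
  · refine O.hasDisjointPathsOn_of_le_ncard (T := S \ {t}) hs.1 ht.1 hst ?_ ?_
    · rintro x ⟨hx, hxt⟩
      exact ⟨hx, hxt, fun _ => harc₂ s hs.1 hst, fun hxs => ⟨harc₁ x hx hxs, harc₂ x hx hxt⟩⟩
    · rw [Set.ncard_sdiff_singleton_of_mem ht.1]
      omega

end CrossOrientation

theorem ncard_label_mem {d : ℕ} (lab : CrossLabeling d) {F : Finset ℕ}
    (hF : F ⊆ Finset.Icc 1 (2 * d)) : {v | (lab v : ℕ) ∈ F}.ncard = F.card := by
  have himg : (fun v => (lab v : ℕ)) '' {v | (lab v : ℕ) ∈ F} = F := by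
    ext n
    constructor
    · rintro ⟨v, hv, rfl⟩
      exact hv
    · intro hn
      have := Finset.mem_Icc.1 (hF hn)
      obtain ⟨v, rfl⟩ := lab.exists_eq this.1 this.2
      exact ⟨v, hn, rfl⟩
  rw [← Set.ncard_image_of_injective _ (fun a b hab => lab.val_inj.1 hab), himg,
    Set.ncard_coe_finset]

theorem isHoltKlee_of_hasPairSequence {O : CrossOrientation 4} (hO : O.IsAcyclic)
    (hπ : O.HasPairSequence {{1, 3}, {2, 4}, {5, 7}, {6, 8}}) :
    IsHoltKlee (crosspolytope 4) O := by
  have hd : 2 ≤ 4 := by norm_num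
  obtain ⟨lab, hlab, hpairs⟩ := hπ
  have harc : ∀ v w, (lab v : ℕ) < lab w → ({(lab v : ℕ), (lab w : ℕ)} : Finset ℕ) ∉
      ({{1, 3}, {2, 4}, {5, 7}, {6, 8}} : Finset (Finset ℕ)) → O.arc v w := fun v w h1 h2 =>
    hlab.arc_of_notMem_pairs hd h1 (by rwa [hpairs])
  have hex : ∀ n, 1 ≤ n → n ≤ 8 → ∃ v, (lab v : ℕ) = n := fun n h1 h2 => lab.exists_eq h1 h2
  obtain ⟨v₁, e₁⟩ := hex 1 (by norm_num) (by norm_num)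
  obtain ⟨v₂, e₂⟩ := hex 2 (by norm_num) (by norm_num)
  obtain ⟨v₇, e₇⟩ := hex 7 (by norm_num) (by norm_num)
  obtain ⟨v₈, e₈⟩ := hex 8 (by norm_num) (by norm_num)
  have hsource : ∀ v, O.IsSourceOn Set.univ v → (lab v : ℕ) = 1 := by
    intro v hv
    have h1 := hv.2 v₁ trivial
    have h2 := hv.2 v₂ trivial
    by_contra hne
    by_cases h3 : (lab v : ℕ) = 3
    -- Label 3 is antipodal to label 1, but it receives an arc from label 2. Symmetrically, label 6
    -- below sends an arc to label 7.
    · exact h2 (harc _ _ (by omega) (by rw [e₂, h3]; decide))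
    · refine h1 (harc _ _ (by have := lab.one_le v; omega) ?_)
      have b1 := lab.one_le v
      have b2 := lab.le v
      rw [e₁]
      generalize (lab v : ℕ) = n at *
      interval_cases n <;> first | decide | omega
  have hsink : ∀ v, O.IsSinkOn Set.univ v → (lab v : ℕ) = 8 := by
    intro v hv
    have h1 := hv.2 v₈ trivial
    have h2 := hv.2 v₇ trivial
    by_contra hne
    by_cases h3 : (lab v : ℕ) = 6
    · exact h2 (harc _ _ (by omega) (by rw [e₇, h3]; decide))
    · refine h1 (harc _ _ (by have := lab.le v; omega) ?_)
      have b1 := lab.one_le v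
      have b2 := lab.le v
      rw [e₈]
      generalize (lab v : ℕ) = n at *
      interval_cases n <;> first | decide | omega
  refine ⟨hO, ?_, ?_, ?_⟩
  · intro S hS hne
    refine existsUnique_of_exists_of_unique (hlab.exists_isSourceOn hne) fun v w hv hw => ?_
    rw [polyFaces_crosspolytope] at hS
    rcases hS with rfl | hS
    · exact lab.val_inj.1 ((hsource v hv).trans (hsource w hw).symm)
    · by_contra hvw
      rcases CrossOrientation.arc_or_arc_of_isAntipodeFree (O := O) hd hS hv.1 hw.1 hvw with h | h
      · exact hw.2 v hv.1 h
      · exact hv.2 w hw.1 h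
  · intro S hS hne
    refine existsUnique_of_exists_of_unique (hlab.exists_isSinkOn hne) fun v w hv hw => ?_
    rw [polyFaces_crosspolytope] at hS
    rcases hS with rfl | hS
    · exact lab.val_inj.1 ((hsink v hv).trans (hsink w hw).symm)
    · by_contra hvw
      rcases CrossOrientation.arc_or_arc_of_isAntipodeFree (O := O) hd hS hv.1 hw.1 hvw with h | h
      · exact hv.2 w hw.1 h
      · exact hw.2 v hv.1 h
  · intro S hS s t hs ht
    rw [polyFaces_crosspolytope] at hS
    rcases hS with rfl | hS
    · have es := hsource s hs
      have et := hsink t ht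
      have hst : s ≠ t := by rintro rfl; omega
      have hdim : faceDim (crosspolytope 4) Set.univ ≤ 4 :=
        (Submodule.finrank_le _).trans (by simp)
      -- The midpoints are all labels other than the ends 1, 8 and their antipodes 3, 6; the four
      -- paths reach the bound 4 on the dimension.
      refine O.hasDisjointPathsOn_of_le_ncard
        (T := {v | (lab v : ℕ) ∈ ({2, 4, 5, 7} : Finset ℕ)}) (Set.mem_univ s)
        (Set.mem_univ t) hst ?_ ?_
      · intro x hx
        rw [Set.mem_ofPred_eq] at hx
        have hxs : x ≠ s := by rintro rfl; rw [es] at hx; revert hx; decide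
        have hxt : x ≠ t := by rintro rfl; rw [et] at hx; revert hx; decide
        refine ⟨trivial, hxt, fun h => absurd h hxs, fun _ => ⟨harc _ _ ?_ ?_, harc _ _ ?_ ?_⟩⟩ <;>
          simp only [es, et] <;> generalize (lab x : ℕ) = n at hx <;> revert n <;> decide
      · rw [ncard_label_mem lab (by decide)]
        exact hdim.trans (by decide)
    · exact CrossOrientation.hasDisjointPathsOn_of_isAntipodeFree hd hS hs ht

theorem mainTheorem4 :
    (∀ d : ℕ, 1 ≤ d →
      -- every acyclic orientation has a pair sequence, and only one
      (∀ O : CrossOrientation d, O.IsAcyclic →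
        ∃! π : Finset (Finset ℕ), π ∈ pairSequences d ∧ O.HasPairSequence π) ∧
      -- labeled acyclic orientations map `2^d d!`-to-1 onto pair sequences
      (∀ π ∈ pairSequences d,
        Nat.card {x : CrossOrientation d × CrossLabeling d //
          x.1.IsAcyclic ∧ x.1.IsLabeledBy x.2 ∧ x.2.pairs = π} = 2 ^ d * d !) ∧
      -- the multiplicity with which unlabeled acyclic orientations map onto pair sequences
      (∀ π ∈ pairSequences d,
        Nat.card {O : CrossOrientation d // O.IsAcyclic ∧ O.HasPairSequence π} =
          orientationMultiplicity d π) ∧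
      -- the LP-orientations are those with a good pair sequence
      (∀ O : CrossOrientation d, O.IsAcyclic →
        (IsLPOrientation (crosspolytope d) O ↔ ∃ π ∈ goodPairSequences d, O.HasPairSequence π)) ∧
      -- the number of labeled LP-orientations, and of LP-orientations
      Nat.card {x : CrossOrientation d × CrossLabeling d //
        IsLPOrientation (crosspolytope d) x.1 ∧ x.1.IsLabeledBy x.2} = 2 ^ d * d ! * numGood d ∧
      Nat.card {O : CrossOrientation d // IsLPOrientation (crosspolytope d) O} =
        ∑ π ∈ goodPairSequences d, orientationMultiplicity d π ∧
      -- the recursion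
      (numGood d : ℤ) = ((2 * d - 1)‼ : ℕ) -
        ∑ k ∈ Finset.Icc 1 (d - 1), (((2 * k - 1)‼ : ℕ) : ℤ) * (numGood (d - k) : ℤ)) ∧
    -- the example in dimension 4
    (∃ O : CrossOrientation 4, O.IsAcyclic ∧
      O.HasPairSequence {{1, 3}, {2, 4}, {5, 7}, {6, 8}}) ∧
    (∀ O : CrossOrientation 4, O.IsAcyclic →
      O.HasPairSequence {{1, 3}, {2, 4}, {5, 7}, {6, 8}} →
        IsHoltKlee (crosspolytope 4) O ∧ ¬ IsLPOrientation (crosspolytope 4) O) := by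
  have hmem : ({{1, 3}, {2, 4}, {5, 7}, {6, 8}} : Finset (Finset ℕ)) ∈ pairSequences 4 :=
    mem_pairSequences.2 ⟨by decide, by decide, by decide⟩
  refine ⟨fun d hd => ⟨fun O hO => ?_, fun π hπ => CrossOrientation.card_labeled_acyclic hπ,
    fun π hπ => CrossOrientation.card_acyclic hd hπ, fun O hO => CrossOrientation.isLP_iff hO,
    CrossOrientation.card_labeled_isLP, CrossOrientation.card_isLP hd, numGood_recursion hd⟩,
    ?_, fun O hO hπ => ⟨isHoltKlee_of_hasPairSequence hO hπ, fun hLP => ?_⟩⟩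
  · obtain ⟨lab, hlab⟩ := CrossOrientation.exists_isLabeledBy hO
    exact ⟨lab.pairs, ⟨lab.pairs_mem_pairSequences, lab, hlab, rfl⟩,
      fun π hπ => CrossOrientation.HasPairSequence.unique hd hπ.2 ⟨lab, hlab, rfl⟩⟩
  · obtain ⟨lab, hlab, -⟩ := exists_labeling hmem
    exact ⟨lab.orientation, lab.orientation_isLabeledBy.isAcyclic, lab,
      lab.orientation_isLabeledBy, hlab⟩
  · obtain ⟨lab, hlab, hpairs⟩ := hπ
    have hgood := hlab.pairs_mem_good_of_isLP hLP
    rw [hpairs, goodPairSequences, Finset.mem_filter, isGoodPairSequence_iff hmem] at hgood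
    -- The pairs `(13)(24)` use exactly the labels `1, …, 4`.
    refine hgood.2 2 (by norm_num) (by norm_num) ?_
    unfold SplitsAt
    decide
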